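/- For a class $\mathcal P$ of probability distributions on $\mathcal X$, say that an $(n,n+m,\varepsilon)$ sample amplification is possible if there is a randomized map (Markov kernel) $T:\mathcal X^n\to\mathcal X^{n+m}$ with $\sup_{P\in\mathcal P}\|P^{\otimes n}\circ T^{-1}-P^{\otimes(n+m)}\|_{\mathrm{TV}}\le\varepsilon$, where $\|P-Q\|_{\mathrm{TV}}=\frac12\int|dP-dQ|$. For $k\ge1$ let $\mathcal P_k$ be the Poissonized discrete distribution model, that is, the class of all product distributions $\prod_{j=1}^k\mathsf{Poi}(p_j)$ with $(p_1,\dots,p_k)$ a probability vector. For every fixed $\varepsilon\in(0,1/10]$, an $(n,n+m,\varepsilon)$ sample amplification is possible for $\mathcal P_k$ if and only if $n=\Omega(1)$ and $m=O(n/\sqrt k+\sqrt n)$. Precisely, there are constants $c,C>0$ and $n_0\in\mathbb N$, depending only on $\varepsilon$, such that: 1. for all $k\ge1$ and all integers $n,m\ge0$ with $m\le c\,(n/\sqrt k+\sqrt n)$, an $(n,n+m,\varepsilon)$ amplification is possible for $\mathcal P_k$; 2. for all $k\ge1$ and all $n\ge n_0$, an $(n,n+1,\varepsilon)$ amplification is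 possible for $\mathcal P_k$; 3. for all $k\ge2$, $n\ge0$ and $m\ge1$, if an $(n,n+m,\varepsilon)$ amplification is possible for $\mathcal P_k$, then $n\ge1$ and $m\le C\,(n/\sqrt k+\sqrt n)$. -/

import Mathlib

open MeasureTheory ProbabilityTheory
open scoped NNReal

/-- Total variation distance `(1/2) ∫ |dP - dQ|` of two (finite) measures, computed with the
densities of `P` and `Q` with respect to the common dominating measure `P + Q`. -/
noncomputable def tvDistance {α : Type*} [MeasurableSpace α] (P Q : Measure α) : ℝ :=
  (1 / 2 : ℝ) *
    ∫ x, |(P.rnDeriv (P + Q) x).toReal - (Q.rnDeriv (P + Q) x).toReal| ∂(P + Q)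

/-- The law `P^{⊗ n}` of `n` i.i.d. samples from `P`. -/
noncomputable def iidLaw {𝓧 : Type*} [MeasurableSpace 𝓧] (P : Measure 𝓧) (n : ℕ) :
    Measure (Fin n → 𝓧) :=
  Measure.pi fun _ : Fin n => P

/-- The class `𝓟` of distributions on `𝓧` admits an `(n, n + m, ε)` sample amplification
procedure: there is a randomized map `T : 𝓧^n → 𝓧^(n+m)` (a Markov kernel, which does not depend
on `P`) such that for every `P ∈ 𝓟` the law of the output of `T` on `n` i.i.d. samples from `P`
is within total variation distance `ε` of the law of `n + m` i.i.d. samples from `P`. -/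
def AdmitsAmplification {𝓧 : Type*} [MeasurableSpace 𝓧] (𝓟 : Set (Measure 𝓧))
    (n m : ℕ) (ε : ℝ) : Prop :=
  ∃ T : Kernel (Fin n → 𝓧) (Fin (n + m) → 𝓧), IsMarkovKernel T ∧
    ∀ P ∈ 𝓟, tvDistance ((iidLaw P n).bind T) (iidLaw P (n + m)) ≤ ε

/-- The Poissonized discrete distribution model with `k` cells: all product distributions
`∏_{j ≤ k} Poi(p_j)` on `ℕ^k`, where `(p_1, …, p_k)` is a probability vector. -/
def poissonizedModel (k : ℕ) : Set (Measure (Fin k → ℕ)) :=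
  {P | ∃ p : Fin k → ℝ≥0, ∑ j, p j = 1 ∧ P = Measure.pi fun j => poissonMeasure (p j)}

/-! The coordinatewise sum of the sample is sufficient, so amplification amounts to turning one
vector of Poisson counts with rates `n p` into one with rates `(n + m) p`. Two product Poisson laws
have Hellinger affinity `exp (-D / 2)`, where `D` is the sum of the squared differences of the
square roots of their rates, and total variation is controlled through `D` (`tvLe_poissonPi`).

Achievability. For `m` of order `√n`, returning the counts unchanged is enough: `D = (√(n + m) - √n)
^ 2 ≤ m ^ 2 / n`, whatever `k` is. For `m` of order `n / √k`, the counts are split into two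
independent halves. The first half estimates the rates, and fresh Poisson counts with the estimated
missing rates are added. Given the first half, the second half plus the fresh counts is again
Poisson, and each cell contributes at most `r ^ 2` to the expected `D`, with `r = 2 m / n`; hence
`D` is at most `k r ^ 2` on average (`tvLe_bind_plugInKernel`).

Converse. A category of probability `1 / m` is nearly invisible in `n` samples if `m ≥ 20 n`, but
shows up among `m` fresh ones with probability `1 - 1 / e`; so `m < 20 n`
(`AdmitsAmplification.lt_mul`). Next, `d` pairs of categories are tilted by hidden signs, so weakly
that `n` samples leave each sign uncertain. Then `m` genuine extra samples lower the total squared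
loss for estimating the signs by order `d m / n`. A kernel that does not know the signs cannot lower
the Bayes risk, and the loss fluctuates only by order `√d`, so a larger gain would be detected by a
threshold test (`bayes_risk_sub_le`). Therefore `m = O(n / √d)`, and `d = min n (k / 2)` gives the
bound. -/

set_option linter.unusedSectionVars false

/-! ### Total variation through test functions. -/

section TotalVariation

variable {α β : Type*} [MeasurableSpace α] [DiscreteMeasurableSpace α]
  [MeasurableSpace β] [DiscreteMeasurableSpace β]

/-- `P` exceeds `Q` by at most `ε` on every test function with values in `[0, 1]`. -/
def TVLe {α : Type*} [MeasurableSpace α] (P Q : Measure α) (ε : ℝ) : Prop :=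
  ∀ f : α → ℝ, (∀ x, 0 ≤ f x) → (∀ x, f x ≤ 1) → ∫ x, f x ∂P ≤ ∫ x, f x ∂Q + ε

lemma integrable_of_abs_le (P : Measure α) [IsFiniteMeasure P] {f : α → ℝ} (C : ℝ)
    (h : ∀ x, |f x| ≤ C) : Integrable f P :=
  Integrable.of_bound Measurable.of_discrete.aestronglyMeasurable C (.of_forall h)

lemma integrable_of_mem_unit (P : Measure α) [IsFiniteMeasure P] {f : α → ℝ}
    (h0 : ∀ x, 0 ≤ f x) (h1 : ∀ x, f x ≤ 1) : Integrable f P :=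
  integrable_of_abs_le P 1 fun x => abs_le.2 ⟨by linarith [h0 x], h1 x⟩

lemma integral_mem_unit (P : Measure α) [IsProbabilityMeasure P] {f : α → ℝ}
    (h0 : ∀ x, 0 ≤ f x) (h1 : ∀ x, f x ≤ 1) : 0 ≤ ∫ x, f x ∂P ∧ ∫ x, f x ∂P ≤ 1 := by
  refine ⟨integral_nonneg h0, ?_⟩
  calc ∫ x, f x ∂P ≤ ∫ _, (1 : ℝ) ∂P :=
        integral_mono (integrable_of_mem_unit P h0 h1) (integrable_const _) h1
    _ = 1 := by simp

/-- The difference of the densities integrates to zero, so its positive part integrates to half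
of the integral of its absolute value. -/
lemma integral_test_mul_le {μ : Measure α} {g f : α → ℝ} (hg : Integrable g μ)
    (hg0 : ∫ x, g x ∂μ = 0) (h0 : ∀ x, 0 ≤ f x) (h1 : ∀ x, f x ≤ 1) :
    ∫ x, g x * f x ∂μ ≤ (1 / 2) * ∫ x, |g x| ∂μ := by
  have hint : Integrable (fun x => g x * f x) μ := by
    refine hg.mono Measurable.of_discrete.aestronglyMeasurable (.of_forall fun x => ?_)
    rw [norm_mul, Real.norm_of_nonneg (h0 x)]
    exact mul_le_of_le_one_right (norm_nonneg _) (h1 x)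
  calc ∫ x, g x * f x ∂μ ≤ ∫ x, (1 / 2) * (|g x| + g x) ∂μ := by
        refine integral_mono hint ((hg.abs.add hg).const_mul _) fun x => ?_
        have h0 := h0 x
        have h1 := h1 x
        rcases abs_cases (g x) with ⟨h, h'⟩ | ⟨h, h'⟩ <;> simp only [h] <;> nlinarith
    _ = (1 / 2) * ∫ x, |g x| ∂μ := by
        rw [integral_const_mul, integral_add hg.abs hg, hg0, add_zero]

lemma integral_eq_integral_density (P Q : Measure α) [IsProbabilityMeasure P]
    [IsProbabilityMeasure Q] (f : α → ℝ) :
    ∫ x, f x ∂P = ∫ x, (P.rnDeriv (P + Q) x).toReal * f x ∂(P + Q) ∧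
    ∫ x, f x ∂Q = ∫ x, (Q.rnDeriv (P + Q) x).toReal * f x ∂(P + Q) :=
  ⟨(integral_toReal_rnDeriv_mul
      (Measure.AbsolutelyContinuous.rfl.add_right Q)).symm,
    (integral_toReal_rnDeriv_mul
      (Measure.absolutelyContinuous_of_le (Measure.le_add_left le_rfl))).symm⟩

lemma integral_density_sub_eq_zero (P Q : Measure α) [IsProbabilityMeasure P]
    [IsProbabilityMeasure Q] :
    ∫ x, ((P.rnDeriv (P + Q) x).toReal - (Q.rnDeriv (P + Q) x).toReal) ∂(P + Q) = 0 := by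
  rw [integral_sub Measure.integrable_toReal_rnDeriv Measure.integrable_toReal_rnDeriv]
  have h := integral_eq_integral_density P Q fun _ => 1
  simp only [mul_one] at h
  rw [← h.1, ← h.2]; simp

lemma TVLe.of_tvDistance_le {P Q : Measure α} [IsProbabilityMeasure P] [IsProbabilityMeasure Q]
    {ε : ℝ} (h : tvDistance P Q ≤ ε) : TVLe P Q ε := by
  intro f h0 h1
  have key := integral_test_mul_le
    (Measure.integrable_toReal_rnDeriv.sub Measure.integrable_toReal_rnDeriv)
    (integral_density_sub_eq_zero P Q) h0 h1
  have hP := integral_eq_integral_density P Q f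
  have i1 : Integrable (fun x => (P.rnDeriv (P + Q) x).toReal * f x) (P + Q) :=
    (integrable_toReal_rnDeriv_mul_iff (Measure.AbsolutelyContinuous.rfl.add_right Q)).2
      (integrable_of_mem_unit P h0 h1)
  have i2 : Integrable (fun x => (Q.rnDeriv (P + Q) x).toReal * f x) (P + Q) :=
    (integrable_toReal_rnDeriv_mul_iff
      (Measure.absolutelyContinuous_of_le (Measure.le_add_left le_rfl))).2
      (integrable_of_mem_unit Q h0 h1)
  simp only [Pi.sub_apply, sub_mul] at key
  rw [integral_sub i1 i2, ← hP.1, ← hP.2] at key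
  unfold tvDistance at h
  linarith

/-- The supremum over test functions is attained at the indicator of the set where the density of
`P` is at least that of `Q`. -/
lemma TVLe.tvDistance_le {P Q : Measure α} [IsProbabilityMeasure P] [IsProbabilityMeasure Q]
    {ε : ℝ} (h : TVLe P Q ε) : tvDistance P Q ≤ ε := by
  classical
  set g : α → ℝ := fun x => (P.rnDeriv (P + Q) x).toReal - (Q.rnDeriv (P + Q) x).toReal with hg
  set f : α → ℝ := fun x => if 0 ≤ g x then 1 else 0 with hf
  have h0 : ∀ x, 0 ≤ f x := fun x => by simp only [hf]; split_ifs <;> norm_num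
  have h1 : ∀ x, f x ≤ 1 := fun x => by simp only [hf]; split_ifs <;> norm_num
  have hh := h f h0 h1
  have hP := integral_eq_integral_density P Q f
  have i1 : Integrable (fun x => (P.rnDeriv (P + Q) x).toReal * f x) (P + Q) :=
    (integrable_toReal_rnDeriv_mul_iff (Measure.AbsolutelyContinuous.rfl.add_right Q)).2
      (integrable_of_mem_unit P h0 h1)
  have i2 : Integrable (fun x => (Q.rnDeriv (P + Q) x).toReal * f x) (P + Q) :=
    (integrable_toReal_rnDeriv_mul_iff
      (Measure.absolutelyContinuous_of_le (Measure.le_add_left le_rfl))).2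
      (integrable_of_mem_unit Q h0 h1)
  have hgi : Integrable g (P + Q) :=
    Measure.integrable_toReal_rnDeriv.sub Measure.integrable_toReal_rnDeriv
  have e : ∫ x, g x * f x ∂(P + Q) = (1 / 2) * ∫ x, |g x| ∂(P + Q) := by
    calc ∫ x, g x * f x ∂(P + Q) = ∫ x, (1 / 2) * (|g x| + g x) ∂(P + Q) := by
          congr 1; ext x
          simp only [hf]
          split_ifs with hx
          · rw [abs_of_nonneg hx]; ring
          · rw [abs_of_neg (not_le.1 hx)]; ring
      _ = _ := by
          rw [integral_const_mul, integral_add hgi.abs hgi, integral_density_sub_eq_zero, add_zero]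
  simp only [hg, sub_mul] at e
  rw [integral_sub i1 i2, ← hP.1, ← hP.2] at e
  unfold tvDistance
  linarith

lemma integral_bind_kernel (P : Measure α) [IsProbabilityMeasure P] (K : Kernel α β)
    [IsMarkovKernel K] {f : β → ℝ} (C : ℝ) (h : ∀ x, |f x| ≤ C) :
    ∫ y, f y ∂(P.bind K) = ∫ x, ∫ y, f y ∂(K x) ∂P := by
  have : P.bind K = (K ∘ₖ Kernel.const Unit P) () := by
    rw [Kernel.comp_apply, Kernel.const_apply]
  rw [this, Kernel.integral_comp, Kernel.const_apply]
  exact integrable_of_abs_le _ C h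

lemma integral_bind_unit (P : Measure α) [IsProbabilityMeasure P] (K : Kernel α β)
    [IsMarkovKernel K] {f : β → ℝ} (h0 : ∀ x, 0 ≤ f x) (h1 : ∀ x, f x ≤ 1) :
    ∫ y, f y ∂(P.bind K) = ∫ x, ∫ y, f y ∂(K x) ∂P :=
  integral_bind_kernel P K 1 fun x => abs_le.2 ⟨by linarith [h0 x], h1 x⟩

lemma TVLe.bind {P Q : Measure α} [IsProbabilityMeasure P] [IsProbabilityMeasure Q] {ε : ℝ}
    (h : TVLe P Q ε) (K : Kernel α β) [IsMarkovKernel K] : TVLe (P.bind K) (Q.bind K) ε := by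
  intro f h0 h1
  rw [integral_bind_unit P K h0 h1, integral_bind_unit Q K h0 h1]
  exact h _ (fun x => (integral_mem_unit (K x) h0 h1).1) fun x => (integral_mem_unit (K x) h0 h1).2

lemma TVLe.map {P Q : Measure α} {ε : ℝ} (h : TVLe P Q ε) (g : α → β) :
    TVLe (P.map g) (Q.map g) ε := by
  intro f h0 h1
  rw [integral_map Measurable.of_discrete.aemeasurable
      Measurable.of_discrete.aestronglyMeasurable,
    integral_map Measurable.of_discrete.aemeasurable Measurable.of_discrete.aestronglyMeasurable]
  exact h _ (fun x => h0 _) fun x => h1 _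

lemma TVLe.mono {P Q : Measure α} {ε ε' : ℝ} (h : TVLe P Q ε) (hε : ε ≤ ε') : TVLe P Q ε' :=
  fun f h0 h1 => (h f h0 h1).trans (by linarith)

/-- Errors conditional on the input average out; this is what allows a comparison of Poisson laws
with random rates. -/
lemma TVLe.bind_right {P : Measure α} [IsProbabilityMeasure P] {K K' : Kernel α β}
    [IsMarkovKernel K] [IsMarkovKernel K'] {e : α → ℝ} (he : Integrable e P)
    (h : ∀ x, TVLe (K x) (K' x) (e x)) : TVLe (P.bind K) (P.bind K') (∫ x, e x ∂P) := by
  intro f h0 h1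
  rw [integral_bind_unit P K h0 h1, integral_bind_unit P K' h0 h1]
  have i : ∀ (K : Kernel α β) [IsMarkovKernel K], Integrable (fun x => ∫ y, f y ∂(K x)) P :=
    fun K _ => integrable_of_mem_unit P (fun x => (integral_mem_unit (K x) h0 h1).1)
      fun x => (integral_mem_unit (K x) h0 h1).2
  rw [← integral_add (i K') he]
  exact integral_mono (i K) ((i K').add he) fun x => h x f h0 h1

end TotalVariation

/-! ### Products of Poisson laws: superposition, i.i.d. blocks, sufficiency. -/

section PoissonProducts

variable {ι κ : Type*} [Fintype ι] [Fintype κ]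

/-- The product of Poisson laws with rates `a i`. -/
noncomputable def poissonPi (a : ι → ℝ≥0) : Measure (ι → ℕ) :=
  Measure.pi fun i => poissonMeasure (a i)

instance (a : ι → ℝ≥0) : IsProbabilityMeasure (poissonPi a) := by
  unfold poissonPi; infer_instance

instance {𝓧 : Type*} [MeasurableSpace 𝓧] (P : Measure 𝓧) [IsProbabilityMeasure P] (n : ℕ) :
    IsProbabilityMeasure (iidLaw P n) := by
  unfold iidLaw; infer_instance

lemma poissonMeasure_zero : poissonMeasure 0 = Measure.dirac 0 := by
  rw [Measure.ext_iff_singleton]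
  intro n
  rw [poissonMeasure_singleton]
  rcases n with _ | n <;> simp

lemma poissonPi_zero : poissonPi (0 : ι → ℝ≥0) = Measure.dirac 0 := by
  classical
  rw [Measure.ext_iff_singleton]
  intro x
  simp only [poissonPi, Measure.pi_singleton, Pi.zero_apply, poissonMeasure_zero]
  by_cases hx : x = 0
  · subst hx; simp
  · obtain ⟨i, hi⟩ : ∃ i, x i ≠ 0 := by
      by_contra! h; exact hx (funext h)
    rw [Finset.prod_eq_zero (Finset.mem_univ i)]
    · simp [Ne.symm hx]
    · simp [Ne.symm hi]

lemma poissonPi_conv (a b : ι → ℝ≥0) :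
    ((poissonPi a).prod (poissonPi b)).map (fun z => z.1 + z.2) = poissonPi (a + b) := by
  have h := (measurePreserving_arrowProdEquivProdArrow ℕ ℕ ι
    (fun i => poissonMeasure (a i)) (fun i => poissonMeasure (b i))).map_eq
  unfold poissonPi
  rw [← h, Measure.map_map Measurable.of_discrete Measurable.of_discrete]
  have : ((fun z : (ι → ℕ) × (ι → ℕ) => z.1 + z.2) ∘
      MeasurableEquiv.arrowProdEquivProdArrow ℕ ℕ ι) =
      fun x i => (fun z : ℕ × ℕ => z.1 + z.2) (x i) := rfl
  rw [this]
  have : ∀ i, ((poissonMeasure (a i)).prod (poissonMeasure (b i))).map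
      (fun z : ℕ × ℕ => z.1 + z.2) = poissonMeasure ((a + b) i) := fun i =>
    poissonMeasure_conv_poissonMeasure (a i) (b i)
  have hs : ∀ i, SigmaFinite (((poissonMeasure (a i)).prod (poissonMeasure (b i))).map
      (fun z : ℕ × ℕ => z.1 + z.2)) := fun i => by rw [this]; infer_instance
  refine (Measure.pi_map_pi (f := fun _ (z : ℕ × ℕ) => z.1 + z.2)
    fun i => Measurable.of_discrete.aemeasurable).trans ?_
  simp_rw [this]

lemma iidLaw_poissonPi_sum (a : ι → ℝ≥0) (n : ℕ) :
    (iidLaw (poissonPi a) n).map (fun x => ∑ i, x i) = poissonPi ((n : ℝ≥0) • a) := by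
  induction n with
  | zero =>
    simp only [Finset.univ_eq_empty, Finset.sum_empty, Nat.cast_zero, zero_smul, poissonPi_zero,
      Measure.map_const, measure_univ, one_smul]
  | succ n ih =>
    have h := (measurePreserving_piFinSuccAbove (fun _ : Fin (n + 1) => poissonPi a) 0).map_eq
    have e : (fun x : Fin (n + 1) → ι → ℕ => ∑ i, x i) =
        (fun z : (ι → ℕ) × (ι → ℕ) => z.1 + z.2) ∘ (Prod.map id fun x : Fin n → ι → ℕ => ∑ i, x i) ∘
        MeasurableEquiv.piFinSuccAbove (fun _ : Fin (n + 1) => ι → ℕ) 0 := by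
      ext x
      simp [Fin.sum_univ_succ, MeasurableEquiv.piFinSuccAbove, Fin.tail]
    rw [e, ← Measure.map_map Measurable.of_discrete Measurable.of_discrete,
      ← Measure.map_map Measurable.of_discrete Measurable.of_discrete]
    unfold iidLaw at ih ⊢
    rw [h, ← Measure.map_prod_map _ _ Measurable.of_discrete Measurable.of_discrete, ih,
      Measure.map_id, poissonPi_conv]
    congr 1
    ext i
    simp [add_mul, add_comm]

/-- Law of the two blocks of an i.i.d. sample. -/
lemma iidLaw_map_blocks {𝓧 : Type*} [MeasurableSpace 𝓧] [Countable 𝓧]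
    [MeasurableSingletonClass 𝓧] (P : Measure 𝓧) [IsProbabilityMeasure P] (n m : ℕ) :
    (iidLaw P (n + m)).map
      (fun x => ((fun i => x (Fin.castAdd m i), fun i => x (Fin.natAdd n i)) :
        (Fin n → 𝓧) × (Fin m → 𝓧))) = (iidLaw P n).prod (iidLaw P m) := by
  rw [Measure.ext_iff_singleton]
  rintro ⟨a, b⟩
  rw [Measure.map_apply Measurable.of_discrete MeasurableSet.of_discrete]
  have : (fun x => ((fun i => x (Fin.castAdd m i), fun i => x (Fin.natAdd n i)) :
        (Fin n → 𝓧) × (Fin m → 𝓧))) ⁻¹' {(a, b)} = {Fin.append a b} := by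
    ext x
    simp only [Set.mem_preimage, Set.mem_singleton_iff, Prod.mk.injEq]
    constructor
    · rintro ⟨rfl, rfl⟩
      exact (Fin.append_castAdd_natAdd).symm
    · rintro rfl
      constructor <;> ext i <;> simp
  rw [this, ← Set.singleton_prod_singleton, Measure.prod_prod]
  simp [iidLaw, Measure.pi_singleton, Fin.prod_univ_add]

lemma pi_map_comp_injective {X : Type*} [MeasurableSpace X] (μ : κ → Measure X)
    [∀ i, IsProbabilityMeasure (μ i)] {f : ι → κ} (hf : f.Injective) :
    (Measure.pi μ).map (fun x i => x (f i)) = Measure.pi fun i => μ (f i) := by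
  have h : iIndepFun (fun i (x : κ → X) => x i) (Measure.pi μ) :=
    iIndepFun_pi (X := fun _ => id) fun i => aemeasurable_id
  have h' := h.precomp hf
  rw [iIndepFun_iff_map_fun_eq_pi_map fun i => (measurable_pi_apply _).aemeasurable] at h'
  rw [show (fun (x : κ → X) i => x (f i)) = fun x i => x (f i) from rfl] at h'
  refine h'.trans ?_
  congr 1
  ext1 i
  exact (measurePreserving_eval μ (f i)).map_eq

/-! ### Sufficiency of the sum -/

/-- Fisher–Neyman factorization: if the density of `P` with respect to `Q` is a function of the
statistic `s`, then `P` is recovered from the law of `s` by sampling from `Q` given `s`. -/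
lemma bind_cond_of_density {Ω S : Type*} [MeasurableSpace Ω] [Countable Ω]
    [MeasurableSingletonClass Ω] [MeasurableSpace S] [Countable S] [MeasurableSingletonClass S]
    (P Q : Measure Ω) [IsProbabilityMeasure P] [IsProbabilityMeasure Q] (s : Ω → S)
    (g : S → ENNReal) (h : ∀ x, P {x} = g (s x) * Q {x})
    (K : Kernel S Ω) [IsMarkovKernel K] (hK : ∀ y, Q (s ⁻¹' {y}) ≠ 0 → K y = Q[|s ⁻¹' {y}]) :
    (P.map s).bind K = P := by
  rw [Measure.ext_iff_singleton]
  intro x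
  have hfib : ∀ y, P (s ⁻¹' {y}) = g y * Q (s ⁻¹' {y}) := by
    intro y
    rw [← Measure.tsum_indicator_apply_singleton P _ MeasurableSet.of_discrete,
      ← Measure.tsum_indicator_apply_singleton Q _ MeasurableSet.of_discrete,
      ← ENNReal.tsum_mul_left]
    congr 1; ext z
    by_cases hz : s z = y
    · subst hz; simp [h]
    · simp [hz]
  rw [Measure.bind_apply (MeasurableSet.singleton x) K.aemeasurable,
    lintegral_countable']
  have hz : ∀ y, y ≠ s x → K y {x} * (P.map s) {y} = 0 := by
    intro y hy
    rw [Measure.map_apply Measurable.of_discrete MeasurableSet.of_discrete, hfib]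
    by_cases h0 : Q (s ⁻¹' {y}) = 0
    · rw [h0]; simp
    · rw [hK y h0, cond_apply MeasurableSet.of_discrete]
      have : s ⁻¹' {y} ∩ {x} = ∅ := by
        ext z; simp only [Set.mem_inter_iff, Set.mem_preimage, Set.mem_singleton_iff,
          Set.mem_empty_iff_false, iff_false, not_and]
        rintro h1 rfl; exact hy h1.symm
      rw [this]; simp
  rw [tsum_eq_single (s x) hz, Measure.map_apply Measurable.of_discrete MeasurableSet.of_discrete,
    hfib, h]
  by_cases h0 : Q (s ⁻¹' {s x}) = 0
  · rw [h0, measure_mono_null (by simp : {x} ⊆ s ⁻¹' {s x}) h0]; simp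
  · rw [hK _ h0, cond_apply MeasurableSet.of_discrete,
      Set.inter_eq_self_of_subset_right (by simp : {x} ⊆ s ⁻¹' {s x})]
    rw [mul_comm, mul_assoc, ← mul_assoc (Q _) _ (Q {x}),
      ENNReal.mul_inv_cancel h0 (measure_ne_top _ _), one_mul]

open Classical in
/-- The conditional law of an i.i.d. sample of standard Poisson vectors given its sum. -/
noncomputable def splitKernel (ι : Type*) [Fintype ι] (n : ℕ) :
    Kernel (ι → ℕ) (Fin n → ι → ℕ) where
  toFun y := if iidLaw (poissonPi (1 : ι → ℝ≥0)) n ((fun x => ∑ i, x i) ⁻¹' {y}) = 0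
    then Measure.dirac 0
    else (iidLaw (poissonPi (1 : ι → ℝ≥0)) n)[|(fun x => ∑ i, x i) ⁻¹' {y}]
  measurable' := Measurable.of_discrete

instance (n : ℕ) : IsMarkovKernel (splitKernel ι n) := by
  refine ⟨fun y => ?_⟩
  change IsProbabilityMeasure (ite _ _ _)
  split_ifs with h
  · infer_instance
  · exact cond_isProbabilityMeasure h

lemma poissonMeasure_singleton_eq_mul (a : ℝ≥0) (x : ℕ) :
    poissonMeasure a {x} = ENNReal.ofReal (Real.exp (1 - a) * a ^ x) * poissonMeasure 1 {x} := by
  rw [poissonMeasure_singleton, poissonMeasure_singleton, ← ENNReal.ofReal_mul (by positivity)]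
  congr 1
  rw [sub_eq_add_neg, Real.exp_add]
  simp only [NNReal.coe_one, one_pow, Real.exp_neg]
  field_simp

/-- The density of the sample at rates `a` against the sample at rates `1` depends only on the total
counts, so one kernel rebuilds the sample from its sum for all `a` at once. The default value of
`splitKernel` sits on fibres that are null for the reference law. -/
lemma splitKernel_bind (a : ι → ℝ≥0) (n : ℕ) :
    (poissonPi ((n : ℝ≥0) • a)).bind (splitKernel ι n) = iidLaw (poissonPi a) n := by
  rw [← iidLaw_poissonPi_sum]
  refine bind_cond_of_density _ (iidLaw (poissonPi 1) n) _
    (fun y => ∏ j, ENNReal.ofReal (Real.exp (1 - a j)) ^ n * ENNReal.ofReal (a j) ^ y j)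
    (fun x => ?_) _ fun y hy => ?_
  · simp only [iidLaw, poissonPi, Measure.pi_singleton, Pi.one_apply]
    rw [Finset.prod_comm]
    conv_rhs => rw [Finset.prod_comm (s := (Finset.univ : Finset (Fin n)))]
    rw [← Finset.prod_mul_distrib]
    refine Finset.prod_congr rfl fun j _ => ?_
    simp_rw [poissonMeasure_singleton_eq_mul (a j)]
    rw [Finset.prod_mul_distrib]
    congr 1
    simp_rw [ENNReal.ofReal_mul (Real.exp_pos _).le, ENNReal.ofReal_pow (NNReal.coe_nonneg _)]
    rw [Finset.prod_mul_distrib, Finset.prod_const, Finset.prod_pow_eq_pow_sum]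
    simp
  · change ite _ _ _ = _
    rw [if_neg hy]

end PoissonProducts

/-! ### Generating function and first two moments of the Poisson law. -/

section PoissonMoments

lemma hasSum_pow_poissonMeasure (a : ℝ≥0) (r : ℝ) :
    HasSum (fun n : ℕ => (Real.exp (-a) * a ^ n / n.factorial) * r ^ n)
      (Real.exp (a * (r - 1))) := by
  convert! (NormedSpace.expSeries_div_hasSum_exp (a * r : ℝ)).mul_left (Real.exp (-a)) using 1
  · ext n; rw [mul_pow]; ring
  · rw [← Real.exp_eq_exp_ℝ, ← Real.exp_add]; ring_nf

lemma integrable_poissonMeasure_of_le_pow (a : ℝ≥0) {f : ℕ → ℝ} (C r : ℝ)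
    (h : ∀ n, |f n| ≤ C * r ^ n) : Integrable f (poissonMeasure a) := by
  rw [integrable_poissonMeasure_iff]
  refine Summable.of_nonneg_of_le (fun n => by positivity) (fun n => ?_)
    ((hasSum_pow_poissonMeasure a r).summable.mul_left C)
  rw [Real.norm_eq_abs]
  calc _ ≤ Real.exp (-a) * a ^ n / n.factorial * (C * r ^ n) := by gcongr; exact h n
    _ = _ := by ring

lemma integral_pow_poissonMeasure (a : ℝ≥0) (r : ℝ) :
    ∫ n, r ^ n ∂(poissonMeasure a) = Real.exp (a * (r - 1)) := by
  rw [integral_poissonMeasure]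
  exact (hasSum_pow_poissonMeasure a r).tsum_eq

lemma natCast_le_two_pow_real (n : ℕ) : (n : ℝ) ≤ 2 ^ n := by
  exact_mod_cast n.lt_two_pow_self.le

lemma integrable_natCast_poissonMeasure (a : ℝ≥0) :
    Integrable (fun n : ℕ => (n : ℝ)) (poissonMeasure a) :=
  integrable_poissonMeasure_of_le_pow a 1 2 fun n => by
    simpa using natCast_le_two_pow_real n

lemma integrable_natCast_sq_poissonMeasure (a : ℝ≥0) :
    Integrable (fun n : ℕ => (n : ℝ) ^ 2) (poissonMeasure a) :=
  integrable_poissonMeasure_of_le_pow a 1 4 fun n => by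
    rw [abs_of_nonneg (by positivity), one_mul, show (4 : ℝ) = 2 * 2 by norm_num, mul_pow, sq]
    gcongr <;> exact natCast_le_two_pow_real n

/-- The Stein–Chen identity. -/
lemma integral_natCast_mul_poissonMeasure (a : ℝ≥0) {g : ℕ → ℝ}
    (hg : Integrable (fun n : ℕ => (n : ℝ) * g n) (poissonMeasure a)) :
    ∫ n, (n : ℝ) * g n ∂(poissonMeasure a) = a * ∫ n, g (n + 1) ∂(poissonMeasure a) := by
  rw [integral_poissonMeasure' hg, (hasSum_integral_poissonMeasure hg).summable.tsum_eq_zero_add,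
    integral_poissonMeasure, ← tsum_mul_left]
  simp only [CharP.cast_eq_zero, zero_mul, smul_zero, zero_add]
  congr 1; ext n
  rw [Nat.factorial_succ]
  push_cast
  simp only [smul_eq_mul]
  field_simp
  ring

lemma integral_natCast_poissonMeasure (a : ℝ≥0) :
    ∫ n, (n : ℝ) ∂(poissonMeasure a) = a := by
  have := integral_natCast_mul_poissonMeasure a (g := fun _ => 1)
    (by simpa using integrable_natCast_poissonMeasure a)
  simpa using this

lemma integral_natCast_sq_poissonMeasure (a : ℝ≥0) :
    ∫ n, (n : ℝ) ^ 2 ∂(poissonMeasure a) = a ^ 2 + a := by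
  have := integral_natCast_mul_poissonMeasure a (g := fun n => (n : ℝ))
    (by simpa [sq] using integrable_natCast_sq_poissonMeasure a)
  simp only [← sq] at this
  rw [this]
  push_cast
  rw [integral_add (integrable_natCast_poissonMeasure a) (integrable_const _),
    integral_natCast_poissonMeasure]
  simp; ring

lemma integrable_sub_sq_poissonMeasure (a : ℝ≥0) (c : ℝ) :
    Integrable (fun n : ℕ => ((n : ℝ) - c) ^ 2) (poissonMeasure a) := by
  simp_rw [sub_sq]
  exact ((integrable_natCast_sq_poissonMeasure a).sub
    (((integrable_natCast_poissonMeasure a).const_mul 2).mul_const c)).add (integrable_const _)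

lemma integral_sub_sq_poissonMeasure (a : ℝ≥0) :
    ∫ n, ((n : ℝ) - a) ^ 2 ∂(poissonMeasure a) = a := by
  simp_rw [sub_sq]
  have i1 := integrable_natCast_sq_poissonMeasure a
  have i2 := ((integrable_natCast_poissonMeasure a).const_mul 2).mul_const (a : ℝ)
  have i3 : Integrable (fun n : ℕ => (n : ℝ) ^ 2 - 2 * n * a) (poissonMeasure a) := i1.sub i2
  rw [integral_add i3 (integrable_const _), integral_sub i1 i2, integral_mul_const,
    integral_const_mul, integral_natCast_poissonMeasure, integral_natCast_sq_poissonMeasure]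
  simp; ring

end PoissonMoments

/-! ### Hellinger affinity and total variation of Poisson products. -/

section Hellinger

variable {ι : Type*} [Fintype ι]

/-- The square root of the density of `poissonPi a` with respect to `poissonPi 1`. -/
noncomputable def sqrtDensity (a : ι → ℝ≥0) (x : ι → ℕ) : ℝ :=
  ∏ i, (Real.exp ((1 - a i) / 2) * √(a i) ^ x i)

lemma sqrtDensity_nonneg (a : ι → ℝ≥0) (x : ι → ℕ) : 0 ≤ sqrtDensity a x :=
  Finset.prod_nonneg fun i _ => by positivity

lemma poissonPi_eq_withDensity (a : ι → ℝ≥0) :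
    poissonPi a = (poissonPi 1).withDensity fun x => ENNReal.ofReal (sqrtDensity a x ^ 2) := by
  rw [Measure.ext_iff_singleton]
  intro x
  rw [withDensity_apply _ (MeasurableSet.singleton x), lintegral_singleton]
  simp only [poissonPi, Measure.pi_singleton, sqrtDensity, Pi.one_apply]
  rw [← Finset.prod_pow, ENNReal.ofReal_prod_of_nonneg fun i _ => by positivity,
    ← Finset.prod_mul_distrib]
  refine Finset.prod_congr rfl fun i _ => ?_
  rw [poissonMeasure_singleton_eq_mul (a i)]
  congr 2
  rw [mul_pow, ← pow_mul, mul_comm (x i), pow_mul, Real.sq_sqrt (NNReal.coe_nonneg _),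
    ← Real.exp_nat_mul]
  congr 2
  push_cast; ring

lemma integral_poissonPi_eq (a : ι → ℝ≥0) (f : (ι → ℕ) → ℝ) :
    ∫ x, f x ∂(poissonPi a) = ∫ x, sqrtDensity a x ^ 2 * f x ∂(poissonPi 1) := by
  rw [poissonPi_eq_withDensity, integral_withDensity_eq_integral_toReal_smul
    Measurable.of_discrete (.of_forall fun x => ENNReal.ofReal_lt_top)]
  congr 1; ext x
  rw [ENNReal.toReal_ofReal (sq_nonneg _), smul_eq_mul]

lemma integrable_poissonPi_iff (a : ι → ℝ≥0) (f : (ι → ℕ) → ℝ) :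
    Integrable f (poissonPi a) ↔ Integrable (fun x => sqrtDensity a x ^ 2 * f x) (poissonPi 1) := by
  rw [poissonPi_eq_withDensity a, integrable_withDensity_iff
    Measurable.of_discrete (.of_forall fun x => ENNReal.ofReal_lt_top)]
  refine iff_of_eq (congrArg (fun g => Integrable g _) ?_)
  ext x
  rw [ENNReal.toReal_ofReal (sq_nonneg _), mul_comm]

lemma sqrtDensity_mul (a b : ι → ℝ≥0) (x : ι → ℕ) :
    sqrtDensity a x * sqrtDensity b x =
      ∏ i, (Real.exp (1 - (a i + b i) / 2) * (√(a i) * √(b i)) ^ x i) := by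
  unfold sqrtDensity
  rw [← Finset.prod_mul_distrib]
  refine Finset.prod_congr rfl fun i _ => ?_
  rw [mul_pow, show (1 : ℝ) - (a i + b i) / 2 = (1 - a i) / 2 + (1 - b i) / 2 by ring, Real.exp_add]
  ring

lemma integrable_sqrtDensity_mul (a b : ι → ℝ≥0) :
    Integrable (fun x => sqrtDensity a x * sqrtDensity b x) (poissonPi 1) := by
  simp_rw [sqrtDensity_mul]
  refine Integrable.fintype_prod
    (f := fun i (n : ℕ) => Real.exp (1 - (a i + b i) / 2) * (√(a i) * √(b i)) ^ n) fun i => ?_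
  exact (integrable_poissonMeasure_of_le_pow _ 1 (√(a i) * √(b i)) fun n => by
    rw [abs_of_nonneg (by positivity), one_mul]).const_mul _

/-- The Hellinger affinity of two products of Poisson laws. -/
lemma integral_sqrtDensity_mul (a b : ι → ℝ≥0) :
    ∫ x, sqrtDensity a x * sqrtDensity b x ∂(poissonPi 1) =
      Real.exp (-(∑ i, (√(a i) - √(b i)) ^ 2) / 2) := by
  simp_rw [sqrtDensity_mul]
  unfold poissonPi
  rw [integral_fintype_prod_eq_prod
    (f := fun i (n : ℕ) => Real.exp (1 - (a i + b i) / 2) * (√(a i) * √(b i)) ^ n)]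
  rw [← Finset.sum_neg_distrib, Finset.sum_div, Real.exp_sum]
  refine Finset.prod_congr rfl fun i _ => ?_
  rw [integral_const_mul, integral_pow_poissonMeasure, ← Real.exp_add]
  congr 1
  rw [sub_sq, Real.sq_sqrt (NNReal.coe_nonneg _), Real.sq_sqrt (NNReal.coe_nonneg _)]
  simp; ring

lemma integral_sqrtDensity_sq (a : ι → ℝ≥0) :
    ∫ x, sqrtDensity a x ^ 2 ∂(poissonPi 1) = 1 := by
  simp_rw [sq]
  rw [integral_sqrtDensity_mul]; simp

lemma one_sub_le_affinity (a b : ι → ℝ≥0) :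
    1 - (∑ i, (√(a i) - √(b i)) ^ 2) / 2 ≤
      ∫ x, sqrtDensity a x * sqrtDensity b x ∂(poissonPi 1) := by
  rw [integral_sqrtDensity_mul]
  have := Real.add_one_le_exp (-(∑ i, (√(a i : ℝ) - √(b i)) ^ 2) / 2)
  linarith

lemma affinity_le_one (a b : ι → ℝ≥0) :
    ∫ x, sqrtDensity a x * sqrtDensity b x ∂(poissonPi 1) ≤ 1 := by
  rw [integral_sqrtDensity_mul, Real.exp_le_one_iff]
  have : 0 ≤ ∑ i, (√(a i : ℝ) - √(b i)) ^ 2 := Finset.sum_nonneg fun i _ => sq_nonneg _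
  linarith

/-- With `p`, `q` the square-root densities, `|p ^ 2 - q ^ 2| = |p - q| (p + q)` is split by the
weighted inequality between arithmetic and geometric means, not by Cauchy–Schwarz. The resulting
bound is affine in the squared distance, so it can be integrated over random rates before `τ` is
chosen. -/
lemma tvLe_poissonPi (a b : ι → ℝ≥0) {τ : ℝ} (hτ : 0 < τ) :
    TVLe (poissonPi a) (poissonPi b) ((∑ i, (√(a i) - √(b i)) ^ 2) / (4 * τ) + τ) := by
  intro f h0 h1
  set p := sqrtDensity a
  set q := sqrtDensity b
  set D := ∑ i, (√(a i : ℝ) - √(b i)) ^ 2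
  have ip : Integrable (fun x => p x ^ 2) (poissonPi 1) := by
    simpa only [sq] using integrable_sqrtDensity_mul a a
  have iq : Integrable (fun x => q x ^ 2) (poissonPi 1) := by
    simpa only [sq] using integrable_sqrtDensity_mul b b
  have ipq : Integrable (fun x => p x * q x) (poissonPi 1) := integrable_sqrtDensity_mul a b
  have ep : ∫ x, p x ^ 2 ∂(poissonPi 1) = 1 := integral_sqrtDensity_sq a
  have eq : ∫ x, q x ^ 2 ∂(poissonPi 1) = 1 := integral_sqrtDensity_sq b
  have ifp := (integrable_poissonPi_iff a f).1 (integrable_of_mem_unit _ h0 h1)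
  have ifq := (integrable_poissonPi_iff b f).1 (integrable_of_mem_unit _ h0 h1)
  have key := integral_test_mul_le (μ := poissonPi 1) (g := fun x => p x ^ 2 - q x ^ 2)
    (ip.sub iq) (by rw [integral_sub ip iq, ep, eq, sub_self]) h0 h1
  simp only [sub_mul] at key
  rw [integral_sub ifp ifq, ← integral_poissonPi_eq, ← integral_poissonPi_eq] at key
  have hc1 : 0 < 1 / (2 * τ) := by positivity
  have habs : ∫ x, |p x ^ 2 - q x ^ 2| ∂(poissonPi 1) ≤
      ∫ x, ((1 / (2 * τ) + τ / 2) * p x ^ 2 + (1 / (2 * τ) + τ / 2) * q x ^ 2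
        + (τ - 1 / τ) * (p x * q x)) ∂(poissonPi 1) := by
    refine integral_mono (ip.sub iq).abs (((ip.const_mul _).add (iq.const_mul _)).add
      (ipq.const_mul _)) fun x => ?_
    have hp : 0 ≤ p x := sqrtDensity_nonneg a x
    have hq : 0 ≤ q x := sqrtDensity_nonneg b x
    have e1 : |p x ^ 2 - q x ^ 2| = |p x - q x| * (p x + q x) := by
      rw [sq_sub_sq, abs_mul, abs_of_nonneg (by positivity : 0 ≤ p x + q x), mul_comm]
    have e2 : (1 / (2 * τ) + τ / 2) * p x ^ 2 + (1 / (2 * τ) + τ / 2) * q x ^ 2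
        + (τ - 1 / τ) * (p x * q x) =
        |p x - q x| * (p x + q x) + 1 / (2 * τ) * (|p x - q x| - τ * (p x + q x)) ^ 2 := by
      have : |p x - q x| ^ 2 = (p x - q x) ^ 2 := sq_abs _
      rw [sub_sq, this]
      field_simp
      ring
    simp only [e1]
    rw [e2]
    have := mul_nonneg hc1.le (sq_nonneg (|p x - q x| - τ * (p x + q x)))
    linarith
  have ipq' : Integrable (fun x => (1 / (2 * τ) + τ / 2) * p x ^ 2 + (1 / (2 * τ) + τ / 2) * q x ^ 2)
    (poissonPi 1) := (ip.const_mul _).add (iq.const_mul _)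
  rw [integral_add ipq' (ipq.const_mul _), integral_add (ip.const_mul _) (iq.const_mul _), integral_const_mul, integral_const_mul,
    integral_const_mul, ep, eq] at habs
  have h1 := one_sub_le_affinity a b
  have h2 := affinity_le_one a b
  change _ ≤ ∫ x, p x * q x ∂(poissonPi 1) at h1
  change ∫ x, p x * q x ∂(poissonPi 1) ≤ _ at h2
  set B := ∫ x, p x * q x ∂(poissonPi 1)
  -- `∫ (p - q) ^ 2 = 2 - 2 B` is at most `D`, and `∫ (p + q) ^ 2 = 2 + 2 B` is at most `4`.
  have hB : (1 / (2 * τ) + τ / 2) * 1 + (1 / (2 * τ) + τ / 2) * 1 + (τ - 1 / τ) * B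
      ≤ D / (2 * τ) + 2 * τ := by
    have : (1 / (2 * τ) + τ / 2) * 1 + (1 / (2 * τ) + τ / 2) * 1 + (τ - 1 / τ) * B
      = 1 / (2 * τ) * (2 - 2 * B) + τ + τ * B := by field_simp; ring
    rw [this, div_eq_mul_one_div D, mul_comm D]
    have := mul_le_mul_of_nonneg_left (by linarith : 2 - 2 * B ≤ D) hc1.le
    have := mul_le_mul_of_nonneg_left h2 hτ.le
    linarith
  have e : D / (4 * τ) + τ = 1 / 2 * (D / (2 * τ) + 2 * τ) := by field_simp; ring
  rw [e]
  linarith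

end Hellinger

/-! ### Achievability: the identity and the plug-in procedure. -/

section Amplification

variable {ι : Type*} [Fintype ι]

/-- The sum is a sufficient statistic, so it suffices to amplify it. -/
lemma admitsAmplification_of_kernel {k n m : ℕ} {ε : ℝ} (K : Kernel (Fin k → ℕ) (Fin k → ℕ))
    [IsMarkovKernel K]
    (h : ∀ p : Fin k → ℝ≥0, ∑ j, p j = 1 →
      TVLe ((poissonPi ((n : ℝ≥0) • p)).bind K) (poissonPi (((n + m : ℕ) : ℝ≥0) • p)) ε) :
    AdmitsAmplification (poissonizedModel k) n m ε := by
  refine ⟨splitKernel (Fin k) (n + m) ∘ₖ (K ∘ₖ Kernel.deterministic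
    (fun x : Fin n → Fin k → ℕ => ∑ i, x i) Measurable.of_discrete), inferInstance, ?_⟩
  rintro P ⟨p, hp, rfl⟩
  change tvDistance ((iidLaw (poissonPi p) n).bind _) (iidLaw (poissonPi p) (n + m)) ≤ ε
  rw [← Measure.comp_assoc, ← Measure.comp_assoc, Measure.deterministic_comp_eq_map,
    iidLaw_poissonPi_sum, ← splitKernel_bind]
  exact ((h p hp).bind _).tvDistance_le

lemma sqrt_sub_sqrt_sq_mul_le {s t : ℝ} (hs : 0 ≤ s) (ht : 0 ≤ t) :
    (√s - √t) ^ 2 * t ≤ (s - t) ^ 2 := by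
  have h1 : s - t = (√s - √t) * (√s + √t) := by
    rw [mul_comm, ← sq_sub_sq, Real.sq_sqrt hs, Real.sq_sqrt ht]
  rw [h1, mul_pow]
  refine mul_le_mul_of_nonneg_left ?_ (sq_nonneg _)
  calc t = √t ^ 2 := (Real.sq_sqrt ht).symm
    _ ≤ (√s + √t) ^ 2 := by
      gcongr
      linarith [Real.sqrt_nonneg s]

/-- Since the weights sum to one, the squared distance collapses to `(√a - √b) ^ 2`, independently
of the number of cells. -/
lemma tvLe_poissonPi_smul (p : ι → ℝ≥0) (hp : ∑ j, p j = 1) {a b : ℝ≥0} {τ δ : ℝ} (hτ : 0 < τ)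
    (h : (√a - √b) ^ 2 ≤ δ) :
    TVLe (poissonPi (a • p)) (poissonPi (b • p)) (δ / (4 * τ) + τ) := by
  refine (tvLe_poissonPi _ _ hτ).mono ?_
  have hp' : ∑ j, (p j : ℝ) = 1 := by exact_mod_cast hp
  have : ∑ i, (√((a • p) i : ℝ≥0) - √((b • p) i : ℝ≥0)) ^ 2 = (√a - √b) ^ 2 := by
    calc _ = ∑ i, (√a - √b) ^ 2 * (p i : ℝ) := by
          refine Finset.sum_congr rfl fun i _ => ?_
          simp only [Pi.smul_apply, smul_eq_mul, NNReal.coe_mul]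
          rw [Real.sqrt_mul (NNReal.coe_nonneg _), Real.sqrt_mul (NNReal.coe_nonneg _), ← sub_mul,
            mul_pow, Real.sq_sqrt (NNReal.coe_nonneg _)]
      _ = _ := by rw [← Finset.mul_sum, hp', mul_one]
  rw [this]
  gcongr

/-- Given two count vectors, use the first one to estimate the rates and add to the total fresh
Poisson counts with `r` times the estimated rates. -/
noncomputable def plugInKernel (ι : Type*) [Fintype ι] (r : ℝ≥0) :
    Kernel (Fin 2 → ι → ℕ) (ι → ℕ) where
  toFun x := (poissonPi fun i => r * (x 0 i : ℝ≥0)).map fun z => x 0 + (x 1 + z)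
  measurable' := Measurable.of_discrete

instance (r : ℝ≥0) : IsMarkovKernel (plugInKernel ι r) :=
  ⟨fun _ => Measure.isProbabilityMeasure_map Measurable.of_discrete.aemeasurable⟩

/-- The law of `u + W` with `W` Poisson of rates `c u`, as a kernel in `u`. -/
noncomputable def shiftKernel (c : (ι → ℕ) → ι → ℝ≥0) : Kernel (ι → ℕ) (ι → ℕ) where
  toFun u := (poissonPi (c u)).map fun w => u + w
  measurable' := Measurable.of_discrete

instance (c : (ι → ℕ) → ι → ℝ≥0) : IsMarkovKernel (shiftKernel c) :=
  ⟨fun _ => Measure.isProbabilityMeasure_map Measurable.of_discrete.aemeasurable⟩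

lemma integral_prod_poissonPi_add (a b : ι → ℝ≥0) {f : (ι → ℕ) → ℝ} (h0 : ∀ x, 0 ≤ f x)
    (h1 : ∀ x, f x ≤ 1) :
    ∫ v, ∫ z, f (v + z) ∂(poissonPi b) ∂(poissonPi a) = ∫ w, f w ∂(poissonPi (a + b)) := by
  rw [← poissonPi_conv, integral_map Measurable.of_discrete.aemeasurable
    Measurable.of_discrete.aestronglyMeasurable, integral_prod]
  exact integrable_of_mem_unit _ (fun _ => h0 _) fun _ => h1 _

/-- Conditionally on the first half `u`, the second half and the fresh counts superpose to a single
Poisson vector with rates `b + r u`. The second half keeps these rates at least `b`, which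
stabilizes their square roots. -/
lemma integral_iidLaw_two_bind_plugInKernel (b : ι → ℝ≥0) (r : ℝ≥0) {f : (ι → ℕ) → ℝ}
    (h0 : ∀ x, 0 ≤ f x) (h1 : ∀ x, f x ≤ 1) :
    ∫ y, f y ∂((iidLaw (poissonPi b) 2).bind (plugInKernel ι r)) =
      ∫ y, f y ∂((poissonPi b).bind (shiftKernel fun u => b + fun i => r * (u i : ℝ≥0))) := by
  rw [integral_bind_unit _ _ h0 h1, integral_bind_unit _ _ h0 h1]
  have hm := (measurePreserving_finTwoArrow (poissonPi b)).symm.map_eq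
  unfold iidLaw
  rw [← hm, integral_map Measurable.of_discrete.aemeasurable
    Measurable.of_discrete.aestronglyMeasurable, integral_prod]
  · congr 1; ext u
    change ∫ v, ∫ y, f y ∂((poissonPi fun i => r * (u i : ℝ≥0)).map fun z => u + (v + z))
        ∂(poissonPi b) = ∫ y, f y ∂((poissonPi (b + fun i => r * (u i : ℝ≥0))).map fun w => u + w)
    rw [integral_map Measurable.of_discrete.aemeasurable
      Measurable.of_discrete.aestronglyMeasurable,
      ← integral_prod_poissonPi_add _ _ (fun _ => h0 _) fun _ => h1 _]
    congr 1; ext v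
    rw [integral_map Measurable.of_discrete.aemeasurable
      Measurable.of_discrete.aestronglyMeasurable]
  · exact integrable_of_mem_unit _ (fun _ => (integral_mem_unit _ h0 h1).1)
      fun _ => (integral_mem_unit _ h0 h1).2

lemma poissonPi_bind_shiftKernel_const (a c : ι → ℝ≥0) {f : (ι → ℕ) → ℝ}
    (h0 : ∀ x, 0 ≤ f x) (h1 : ∀ x, f x ≤ 1) :
    ∫ y, f y ∂((poissonPi a).bind (shiftKernel fun _ => c)) = ∫ y, f y ∂(poissonPi (a + c)) := by
  rw [integral_bind_unit _ _ h0 h1, ← integral_prod_poissonPi_add _ _ h0 h1]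
  congr 1; ext u
  exact integral_map Measurable.of_discrete.aemeasurable
      Measurable.of_discrete.aestronglyMeasurable

/-- Mean squared Hellinger error of the plug-in rate in one coordinate. -/
lemma integral_sqrt_sub_sqrt_sq_le (b r : ℝ≥0) :
    Integrable (fun u : ℕ => (√(b + r * (u : ℝ≥0) : ℝ≥0) - √(b + r * b : ℝ≥0)) ^ 2)
      (poissonMeasure b) ∧
    ∫ u, (√(b + r * (u : ℝ≥0) : ℝ≥0) - √(b + r * b : ℝ≥0)) ^ 2 ∂(poissonMeasure b) ≤ r ^ 2 := by
  -- The bound `(r ^ 2 / b) (u - b) ^ 2` below needs `b > 0`; at rate zero the count vanishes almost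
  -- surely and there is no error.
  rcases eq_or_ne b 0 with rfl | hb
  · rw [poissonMeasure_zero]
    refine ⟨integrable_dirac (by simp), ?_⟩
    rw [integral_dirac]
    simp only [CharP.cast_eq_zero, mul_zero, add_zero, sub_self]
    rw [zero_pow two_ne_zero]
    positivity
  · have hb : (0 : ℝ) < b := by exact_mod_cast pos_iff_ne_zero.2 hb
    have hle : ∀ u : ℕ, (√(b + r * (u : ℝ≥0) : ℝ≥0) - √(b + r * b : ℝ≥0)) ^ 2 ≤
        (r ^ 2 / b) * ((u : ℝ) - b) ^ 2 := by
      intro u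
      have h := sqrt_sub_sqrt_sq_mul_le (NNReal.coe_nonneg (b + r * (u : ℝ≥0)))
        (NNReal.coe_nonneg (b + r * b))
      rw [div_mul_eq_mul_div, le_div_iff₀ hb]
      calc _ ≤ (√(b + r * (u : ℝ≥0) : ℝ≥0) - √(b + r * b : ℝ≥0)) ^ 2 * (b + r * b : ℝ≥0) := by
            gcongr
            nlinarith [NNReal.coe_nonneg r, NNReal.coe_nonneg b]
        _ ≤ _ := h
        _ = _ := by push_cast; ring
    have hi := (integrable_sub_sq_poissonMeasure b b).const_mul ((r : ℝ) ^ 2 / b)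
    have hi' : Integrable (fun u : ℕ => (√(b + r * (u : ℝ≥0) : ℝ≥0) - √(b + r * b : ℝ≥0)) ^ 2)
        (poissonMeasure b) := by
      refine hi.mono Measurable.of_discrete.aestronglyMeasurable (.of_forall fun u => ?_)
      rw [Real.norm_of_nonneg (sq_nonneg _), Real.norm_of_nonneg (by positivity)]
      exact hle u
    refine ⟨hi', (integral_mono hi' hi hle).trans ?_⟩
    rw [integral_const_mul, integral_sub_sq_poissonMeasure]
    field_simp
    exact le_rfl

/-- The ideal output is the same construction with the true rates `b + r b` in place of `b + r u`.
The two are compared given `u`, so reusing `u` in the output costs nothing, and the squared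
distances are then averaged over `u`. -/
lemma tvLe_bind_plugInKernel (b : ι → ℝ≥0) (r : ℝ≥0) {τ : ℝ} (hτ : 0 < τ) :
    TVLe ((poissonPi (((2 : ℕ) : ℝ≥0) • b)).bind (plugInKernel ι r ∘ₖ splitKernel ι 2))
      (poissonPi (b + (b + r • b))) (Fintype.card ι * r ^ 2 / (4 * τ) + τ) := by
  rw [← Measure.comp_assoc, splitKernel_bind]
  intro f h0 h1
  rw [integral_iidLaw_two_bind_plugInKernel b r h0 h1,
    ← poissonPi_bind_shiftKernel_const b (b + r • b) h0 h1]
  have hint : ∀ i, Integrable (fun u : ι → ℕ =>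
      (√(b i + r * (u i : ℝ≥0) : ℝ≥0) - √(b i + r * b i : ℝ≥0)) ^ 2) (poissonPi b) := fun i =>
    integrable_comp_eval (μ := fun i => poissonMeasure (b i)) (i := i)
      (integral_sqrt_sub_sqrt_sq_le (b i) r).1
  have hsum := integrable_finsetSum Finset.univ fun i _ => hint i
  have key := TVLe.bind_right (P := poissonPi b)
    (K := shiftKernel fun u => b + fun i => r * (u i : ℝ≥0)) (K' := shiftKernel fun _ => b + r • b)
    ((hsum.div_const (4 * τ)).add (integrable_const τ))
    (fun u => (tvLe_poissonPi (b + fun i => r * (u i : ℝ≥0)) (b + r • b) hτ).map fun w => u + w)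
  refine (key.mono ?_) f h0 h1
  simp only [Pi.add_apply]
  rw [integral_add (hsum.div_const (4 * τ)) (integrable_const τ), integral_div,
    integral_finsetSum _ fun i _ => hint i]
  simp only [integral_const, probReal_univ, smul_eq_mul, one_mul]
  gcongr
  calc _ ≤ ∑ _i : ι, (r : ℝ) ^ 2 := by
        refine Finset.sum_le_sum fun i _ => ?_
        have := integral_comp_eval (μ := fun i => poissonMeasure (b i)) (i := i)
          (f := fun u : ℕ => (√(b i + r * (u : ℝ≥0) : ℝ≥0) - √(b i + r * b i : ℝ≥0)) ^ 2)
          Measurable.of_discrete.aestronglyMeasurable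
        exact this.trans_le (integral_sqrt_sub_sqrt_sq_le (b i) r).2
    _ = _ := by simp

lemma admitsAmplification_of_le_sqrt {k n m : ℕ} {ε : ℝ} (hε : 0 < ε) (h : (m : ℝ) ≤ ε * √n) :
    AdmitsAmplification (poissonizedModel k) n m ε := by
  refine admitsAmplification_of_kernel Kernel.id fun p hp => ?_
  rw [Measure.id_comp]
  -- The choice `τ = ε / 2` balances the two terms and makes their sum exactly `ε`.
  refine (tvLe_poissonPi_smul p hp (half_pos hε) (δ := ε ^ 2) ?_).mono ?_
  · push_cast
    rcases Nat.eq_zero_or_pos n with rfl | hn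
    · have : (m : ℝ) = 0 := le_antisymm (by simpa using h) (by positivity)
      rw [this]; simp; positivity
    · have hn' : (0 : ℝ) < n := by exact_mod_cast hn
      have := sqrt_sub_sqrt_sq_mul_le (s := n + m) (t := n) (by positivity) hn'.le
      have h2 : ((n : ℝ) + m - n) ^ 2 ≤ ε ^ 2 * n := by
        calc ((n : ℝ) + m - n) ^ 2 = (m : ℝ) ^ 2 := by ring
          _ ≤ (ε * √n) ^ 2 := by gcongr
          _ = _ := by rw [mul_pow, Real.sq_sqrt hn'.le]
      have := le_of_mul_le_mul_right (this.trans h2) hn'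
      rw [← neg_sub, neg_sq]; exact this
  · apply le_of_eq; field_simp; ring

lemma admitsAmplification_of_le_div_sqrt {k n m : ℕ} {ε : ℝ} (hε : 0 < ε) (hk : 1 ≤ k)
    (h : (m : ℝ) ≤ ε / 2 * (n / √k)) :
    AdmitsAmplification (poissonizedModel k) n m ε := by
  rcases Nat.eq_zero_or_pos n with rfl | hn
  · refine admitsAmplification_of_le_sqrt hε ?_
    simpa using h
  have hn' : (0 : ℝ) < n := by exact_mod_cast hn
  have hk' : (0 : ℝ) < k := by exact_mod_cast hk
  -- Each half has rates `b = (n / 2) p`, so `r = 2 m / n` makes the added rates `r b = m p`.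
  refine admitsAmplification_of_kernel
    (plugInKernel (Fin k) (2 * m / n) ∘ₖ splitKernel (Fin k) 2) fun p hp => ?_
  have key := tvLe_bind_plugInKernel (((n : ℝ≥0) / 2) • p) (2 * m / n) (half_pos hε)
  have hn0 : (n : ℝ≥0) ≠ 0 := by exact_mod_cast hn.ne'
  have e1 : ((2 : ℕ) : ℝ≥0) • (((n : ℝ≥0) / 2) • p) = (n : ℝ≥0) • p := by
    rw [smul_smul]; congr 1; push_cast; field_simp
  have e2 : ((n : ℝ≥0) / 2) • p + (((n : ℝ≥0) / 2) • p + (2 * m / n : ℝ≥0) • (((n : ℝ≥0) / 2) • p))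
      = ((n + m : ℕ) : ℝ≥0) • p := by
    rw [smul_smul, ← add_smul, ← add_smul]; congr 1; push_cast; field_simp; ring
  rw [e1, e2] at key
  refine key.mono ?_
  have : (Fintype.card (Fin k) : ℝ) * ((2 * m / n : ℝ≥0) : ℝ) ^ 2 ≤ ε ^ 2 := by
    push_cast
    rw [Fintype.card_fin]
    have : (2 * m / n : ℝ) ≤ ε / √k := by
      rw [div_le_iff₀ hn']
      calc (2 * m : ℝ) ≤ 2 * (ε / 2 * (n / √k)) := by gcongr
        _ = _ := by ring
    calc (k : ℝ) * (2 * m / n : ℝ) ^ 2 ≤ k * (ε / √k) ^ 2 := by gcongr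
      _ = ε ^ 2 := by rw [div_pow, Real.sq_sqrt hk'.le]; field_simp
  calc _ ≤ ε ^ 2 / (4 * (ε / 2)) + ε / 2 := by gcongr
    _ = ε := by field_simp; ring

end Amplification

/-! ### Converse: reduction to fewer categories and the bound `m < 20 n`. -/

section LowerBoundReduction

variable {ι κ : Type*} [Fintype ι] [Fintype κ]

lemma TVLe.symm {α : Type*} [MeasurableSpace α] [DiscreteMeasurableSpace α] {P Q : Measure α}
    [IsProbabilityMeasure P] [IsProbabilityMeasure Q] {ε : ℝ} (h : TVLe P Q ε) : TVLe Q P ε := by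
  intro f h0 h1
  have := h (fun x => 1 - f x) (fun x => by linarith [h1 x]) fun x => by linarith [h0 x]
  rw [integral_sub (integrable_const _) (integrable_of_mem_unit _ h0 h1),
    integral_sub (integrable_const _) (integrable_of_mem_unit _ h0 h1)] at this
  simp only [integral_const, probReal_univ, smul_eq_mul, mul_one] at this
  linarith

lemma poissonPi_map_comp (a : κ → ℝ≥0) {f : ι → κ} (hf : f.Injective) :
    (poissonPi a).map (fun x => x ∘ f) = poissonPi (a ∘ f) :=
  pi_map_comp_injective (fun i => poissonMeasure (a i)) hf

/-- Coordinates of rate zero vanish almost surely, so padding the counts by zeros is the same as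
padding the rates. -/
lemma poissonPi_map_extend (a : ι → ℝ≥0) {f : ι → κ} (hf : f.Injective) :
    (poissonPi a).map (fun x => (Function.extend f x 0 : κ → ℕ)) = poissonPi (Function.extend f a 0) := by
  have h := poissonPi_map_comp (Function.extend f a 0) hf
  rw [Function.extend_comp hf] at h
  rw [← h, Measure.map_map Measurable.of_discrete Measurable.of_discrete]
  conv_rhs => rw [← Measure.map_id (μ := poissonPi (Function.extend f a 0))]
  refine Measure.map_congr ?_
  have hz : ∀ i, i ∉ Set.range f → ∀ᵐ x ∂(poissonPi (Function.extend f a 0)), x i = 0 := by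
    intro i hi
    have hd : ∀ᵐ y ∂(poissonMeasure (Function.extend f a 0 i)), y = 0 := by
      rw [Function.extend_apply' _ _ _ (by simpa using hi), Pi.zero_apply, poissonMeasure_zero,
        ae_dirac_eq]
      rfl
    exact (Measure.tendsto_eval_ae_ae
      (μ := fun i => poissonMeasure (Function.extend f a 0 i))).eventually hd
  have hz' : ∀ᵐ x ∂(poissonPi (Function.extend f a 0)), ∀ i, i ∉ Set.range f → x i = 0 := by
    rw [ae_all_iff]
    intro i
    by_cases hi : i ∈ Set.range f
    · exact .of_forall fun x h => absurd hi h
    · filter_upwards [hz i hi] with x hx _ using hx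
  filter_upwards [hz'] with x hx
  ext i
  simp only [Function.comp_apply, id_eq]
  by_cases hi : i ∈ Set.range f
  · obtain ⟨j, rfl⟩ := hi
    rw [hf.extend_apply]; rfl
  · rw [Function.extend_apply' _ _ _ (by simpa using hi), hx i hi]; rfl

/-- Restricted to the coordinates in the range of `f`, an amplification procedure turns Poisson
counts from `n` samples into two independent blocks, from `n` and `m` samples. -/
lemma AdmitsAmplification.exists_kernel {k n m : ℕ} {ε : ℝ}
    (h : AdmitsAmplification (poissonizedModel k) n m ε) {f : ι → Fin k} (hf : f.Injective) :
    ∃ K : Kernel (ι → ℕ) ((ι → ℕ) × (ι → ℕ)), IsMarkovKernel K ∧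
      ∀ p : ι → ℝ≥0, ∑ i, p i = 1 →
        TVLe ((poissonPi ((n : ℝ≥0) • p)).bind K)
          ((poissonPi ((n : ℝ≥0) • p)).prod (poissonPi ((m : ℝ≥0) • p))) ε := by
  obtain ⟨T, hT, h⟩ := h
  let G : (Fin (n + m) → Fin k → ℕ) → (ι → ℕ) × (ι → ℕ) := fun x =>
    ((∑ i, x (Fin.castAdd m i)) ∘ f, (∑ i, x (Fin.natAdd n i)) ∘ f)
  -- Pad the counts with empty categories, rebuild `n` samples, amplify, then sum each block and
  -- forget the padding.
  refine ⟨(T ∘ₖ (splitKernel (Fin k) n ∘ₖ Kernel.deterministic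
    (fun x : ι → ℕ => (Function.extend f x 0 : Fin k → ℕ)) Measurable.of_discrete)).map G,
    Kernel.IsMarkovKernel.map _ Measurable.of_discrete, fun p hp => ?_⟩
  have hp' : ∑ i, Function.extend f p 0 i = 1 := by
    rw [← hp]
    exact (Fintype.sum_of_injective f hf _ _
      (fun i hi => by rw [Function.extend_apply' _ _ _ (by simpa using hi)]; rfl)
      fun i => by rw [hf.extend_apply]).symm
  have key := h _ ⟨_, hp', rfl⟩
  change tvDistance ((iidLaw (poissonPi _) n).bind T) (iidLaw (poissonPi _) (n + m)) ≤ ε at key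
  have key := (TVLe.of_tvDistance_le key).map G
  have hsmul : ∀ c : ℝ≥0, Function.extend f (c • p) 0 = c • Function.extend f p 0 := by
    intro c
    ext i
    by_cases hi : i ∈ Set.range f
    · obtain ⟨j, rfl⟩ := hi
      simp [hf.extend_apply]
    · simp [Function.extend_apply' _ _ _ (by simpa using hi)]
  have e1 : (poissonPi ((n : ℝ≥0) • p)).bind ((T ∘ₖ (splitKernel (Fin k) n ∘ₖ Kernel.deterministic
      (fun x : ι → ℕ => (Function.extend f x 0 : Fin k → ℕ)) Measurable.of_discrete)).map G) =
      ((iidLaw (poissonPi (Function.extend f p 0)) n).bind T).map G := by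
    rw [← Measure.map_comp _ _ Measurable.of_discrete, ← Measure.comp_assoc, ← Measure.comp_assoc,
      Measure.deterministic_comp_eq_map, poissonPi_map_extend _ hf, hsmul, splitKernel_bind]
  have e2 : (iidLaw (poissonPi (Function.extend f p 0)) (n + m)).map G =
      (poissonPi ((n : ℝ≥0) • p)).prod (poissonPi ((m : ℝ≥0) • p)) := by
    have hG : G = Prod.map (fun x : Fin k → ℕ => x ∘ f) (fun x : Fin k → ℕ => x ∘ f) ∘
        Prod.map (fun x : Fin n → Fin k → ℕ => ∑ i, x i) (fun x : Fin m → Fin k → ℕ => ∑ i, x i) ∘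
        fun x => (fun i => x (Fin.castAdd m i), fun i => x (Fin.natAdd n i)) := rfl
    rw [hG, ← Measure.map_map Measurable.of_discrete Measurable.of_discrete,
      ← Measure.map_map Measurable.of_discrete Measurable.of_discrete, iidLaw_map_blocks,
      ← Measure.map_prod_map _ _ Measurable.of_discrete Measurable.of_discrete,
      iidLaw_poissonPi_sum, iidLaw_poissonPi_sum, ← hsmul, ← hsmul,
      ← Measure.map_prod_map _ _ Measurable.of_discrete Measurable.of_discrete,
      poissonPi_map_comp _ hf, poissonPi_map_comp _ hf, Function.extend_comp hf,
      Function.extend_comp hf]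
  rw [e1, ← e2]
  exact key

lemma integral_poissonMeasure_ne_zero (a : ℝ≥0) :
    ∫ n, (if n = 0 then (0 : ℝ) else 1) ∂(poissonMeasure a) = 1 - Real.exp (-a) := by
  have h : ∀ n : ℕ, (if n = 0 then (0 : ℝ) else 1) = 1 - 0 ^ n := fun n => by
    split_ifs with h
    · simp [h]
    · simp [h]
  simp_rw [h]
  rw [integral_sub (integrable_const _)
    (integrable_poissonMeasure_of_le_pow a 1 0 fun n => by
      rw [one_mul, abs_of_nonneg (by positivity)]), integral_pow_poissonMeasure]
  simp

/-- A rare second category tells apart samples whose sizes differ by a large factor. -/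
lemma AdmitsAmplification.lt_mul {k n m : ℕ} {ε : ℝ} (hε : ε ≤ 1 / 10) (hk : 2 ≤ k) (hm : 1 ≤ m)
    (h : AdmitsAmplification (poissonizedModel k) n m ε) : m < 20 * n := by
  by_contra! hnm
  obtain ⟨K, hK, h⟩ := h.exists_kernel (Fin.castLE_injective hk)
  have hm' : (1 : ℝ≥0) ≤ m := by exact_mod_cast hm
  have hm0 : (0 : ℝ) < m := by exact_mod_cast hm
  have hinv : (m : ℝ≥0)⁻¹ ≤ 1 := inv_le_one_of_one_le₀ hm'
  have hmne : (m : ℝ≥0) ≠ 0 := by exact_mod_cast (by omega : m ≠ 0)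
  -- The rare category has expected count `1` in the fresh block under `p₁`, and at most `1 / 20` in
  -- the input.
  set p₀ : Fin 2 → ℝ≥0 := ![1, 0] with hp₀
  set p₁ : Fin 2 → ℝ≥0 := ![1 - (m : ℝ≥0)⁻¹, (m : ℝ≥0)⁻¹] with hp₁
  have h₀ := h p₀ (by simp [hp₀])
  have h₁ := (h p₁ (by simp [hp₁, tsub_add_cancel_of_le hinv])).symm
  have hnm' : (20 : ℝ) * n ≤ m := by exact_mod_cast hnm
  have hD : ∑ i, (√(((n : ℝ≥0) • p₁) i : ℝ≥0) - √(((n : ℝ≥0) • p₀) i : ℝ≥0)) ^ 2 ≤ 1 / 10 := by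
    rw [Fin.sum_univ_two]
    have h1 : (√(((n : ℝ≥0) • p₁) 1 : ℝ≥0) - √(((n : ℝ≥0) • p₀) 1 : ℝ≥0)) ^ 2 ≤ 1 / 20 := by
      simp only [hp₀, hp₁, Pi.smul_apply, Matrix.cons_val_one, Matrix.cons_val_fin_one, smul_zero,
        NNReal.coe_zero, Real.sqrt_zero, sub_zero, Real.sq_sqrt (NNReal.coe_nonneg _)]
      rw [smul_eq_mul]
      push_cast
      rw [← div_eq_mul_inv, div_le_iff₀ hm0]
      linarith
    have h2 : (√(((n : ℝ≥0) • p₁) 0 : ℝ≥0) - √(((n : ℝ≥0) • p₀) 0 : ℝ≥0)) ^ 2 ≤ 1 / 20 := by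
      have := sqrt_sub_sqrt_sq_mul_le (NNReal.coe_nonneg (((n : ℝ≥0) • p₁) 0))
        (NNReal.coe_nonneg (((n : ℝ≥0) • p₀) 0))
      rcases Nat.eq_zero_or_pos n with rfl | hn
      · simp
      have hn' : (0 : ℝ) < n := by exact_mod_cast hn
      refine le_of_mul_le_mul_right (this.trans ?_)
        (show 0 < ((((n : ℝ≥0) • p₀) 0 : ℝ≥0) : ℝ) by simpa [hp₀] using hn)
      simp only [hp₀, hp₁, Pi.smul_apply, Matrix.cons_val_zero, smul_eq_mul, mul_one]
      push_cast [NNReal.coe_sub hinv]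
      have e : (n * (1 - (m : ℝ)⁻¹) - n) ^ 2 = (n / m) * (m : ℝ)⁻¹ * n := by
        field_simp; ring
      rw [e]
      have a1 : (n / m : ℝ) ≤ 1 / 20 := by rw [div_le_iff₀ hm0]; linarith
      have a2 : (m : ℝ)⁻¹ ≤ 1 := by exact_mod_cast hinv
      have a3 : (n / m : ℝ) * (m : ℝ)⁻¹ ≤ 1 / 20 * 1 := by gcongr
      rw [mul_one] at a3
      gcongr
    linarith
  -- With `D ≤ 1 / 10` and `τ = 1 / 6` the bound is `3 / 20 + 1 / 6 = 19 / 60`.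
  have h₀₁ := ((tvLe_poissonPi ((n : ℝ≥0) • p₁) ((n : ℝ≥0) • p₀)
    (by norm_num : (0 : ℝ) < 1 / 6)).mono (ε' := 19 / 60) 
      ((add_le_add_left (div_le_div_of_nonneg_right hD (by norm_num)) _).trans
        (by norm_num))).bind K
  -- The test asks whether the fresh block contains the rare category: probability `1 - 1 / e` under
  -- `p₁` and `0` under `p₀`, a gap exceeding `2 ε + 19 / 60`.
  set f : (Fin 2 → ℕ) × (Fin 2 → ℕ) → ℝ := fun z => if z.2 1 = 0 then 0 else 1 with hf
  have f0 : ∀ x, 0 ≤ f x := fun x => by simp only [hf]; split_ifs <;> norm_num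
  have f1 : ∀ x, f x ≤ 1 := fun x => by simp only [hf]; split_ifs <;> norm_num
  have hint : ∀ a b : Fin 2 → ℝ≥0, ∫ z, f z ∂((poissonPi a).prod (poissonPi b)) =
      1 - Real.exp (-(b 1)) := by
    intro a b
    rw [← integral_poissonMeasure_ne_zero]
    have := integral_comp_eval (μ := fun i => poissonMeasure (b i)) (i := 1)
      (f := fun n : ℕ => if n = 0 then (0 : ℝ) else 1) Measurable.of_discrete.aestronglyMeasurable
    rw [← this]
    exact (integral_fun_snd (μ := poissonPi a) (ν := poissonPi b)
      fun z => if z 1 = 0 then (0 : ℝ) else 1).trans (by simp; rfl)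
  have k1 := h₁ f f0 f1
  have k0 := h₀ f f0 f1
  have k01 := h₀₁ f f0 f1
  rw [hint] at k0 k1
  simp only [hp₀, hp₁, Pi.smul_apply, Matrix.cons_val_one, Matrix.cons_val_fin_one, smul_eq_mul,
    mul_zero, mul_inv_cancel₀ hmne, NNReal.coe_zero, NNReal.coe_one, neg_zero, Real.exp_zero]
    at k0 k1 k01
  have := Real.exp_neg_one_lt_d9
  linarith

end LowerBoundReduction

/-! ### Bayes risk of many signs under a kernel. -/

section Bayes

/-- Chebyshev's inequality, each summand having variance at most `B ^ 2`. -/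
lemma pi_real_abs_sub_ge_le {ι Ω : Type*} [Fintype ι] [MeasurableSpace Ω]
    [DiscreteMeasurableSpace Ω] [Countable Ω]
    (μ : ι → Measure Ω) [∀ i, IsProbabilityMeasure (μ i)] (f : ι → Ω → ℝ) {B c : ℝ}
    (hf : ∀ i x, |f i x| ≤ B) (hc : 0 < c) :
    (Measure.pi μ).real {x | c ≤ |∑ i, f i (x i) - ∑ i, ∫ y, f i y ∂(μ i)|} ≤
      Fintype.card ι * B ^ 2 / c ^ 2 := by
  have hL : ∀ i, MemLp (f i) 2 (μ i) := fun i =>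
    MemLp.of_bound Measurable.of_discrete.aestronglyMeasurable B (.of_forall (hf i))
  have hLc : ∀ i, MemLp (fun x : ι → Ω => f i (x i)) 2 (Measure.pi μ) := fun i =>
    MemLp.of_bound Measurable.of_discrete.aestronglyMeasurable B (.of_forall fun x => hf i _)
  have hmean : ∫ x, ∑ i, f i (x i) ∂(Measure.pi μ) = ∑ i, ∫ y, f i y ∂(μ i) := by
    rw [integral_finsetSum _ fun i _ => (hLc i).integrable (by norm_num)]
    exact Finset.sum_congr rfl fun i _ =>
      integral_comp_eval Measurable.of_discrete.aestronglyMeasurable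
  have hsum : MemLp (fun x : ι → Ω => ∑ i, f i (x i)) 2 (Measure.pi μ) :=
    memLp_finsetSum _ fun i _ => hLc i
  have hvar : Var[fun x : ι → Ω => ∑ i, f i (x i); Measure.pi μ] ≤ Fintype.card ι * B ^ 2 := by
    have := variance_sum_pi hL
    have e : (∑ i, fun x : ι → Ω => f i (x i)) = fun x : ι → Ω => ∑ i, f i (x i) := by
      ext x; simp
    rw [e] at this
    rw [this]
    calc _ ≤ ∑ _i : ι, B ^ 2 := by
          refine Finset.sum_le_sum fun i _ => ?_
          refine (variance_le_expectation_sq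
            Measurable.of_discrete.aestronglyMeasurable).trans ?_
          calc ∫ x, (f i ^ 2) x ∂(μ i) ≤ ∫ _, B ^ 2 ∂(μ i) := by
                refine integral_mono (hL i).integrable_sq (integrable_const _) fun x => ?_
                exact sq_le_sq' (abs_le.1 (hf i x)).1 (abs_le.1 (hf i x)).2
            _ = B ^ 2 := by simp
      _ = _ := by simp
  have h := meas_ge_le_variance_div_sq hsum hc
  rw [hmean] at h
  rw [measureReal_def]
  refine (ENNReal.toReal_mono ENNReal.ofReal_ne_top h).trans ?_
  rw [ENNReal.toReal_ofReal (div_nonneg (variance_nonneg _ _) (sq_nonneg _))]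
  gcongr

/-- The sign `±1` encoded by a Boolean. -/
def boolSign (b : Bool) : ℝ := if b then 1 else -1

lemma boolSign_sq (b : Bool) : boolSign b ^ 2 = 1 := by
  cases b <;> simp [boolSign]

lemma abs_boolSign (b : Bool) : |boolSign b| = 1 := by
  cases b <;> simp [boolSign]

/-- The law on signs with mean `e`. -/
noncomputable def signLaw (e : ℝ) : Measure Bool :=
  ENNReal.ofReal ((1 + e) / 2) • Measure.dirac true +
    ENNReal.ofReal ((1 - e) / 2) • Measure.dirac false

lemma signLaw_isProbabilityMeasure {e : ℝ} (he : |e| ≤ 1) : IsProbabilityMeasure (signLaw e) := by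
  refine ⟨?_⟩
  have := abs_le.1 he
  simp only [signLaw, Measure.coe_add, Measure.coe_smul, Pi.add_apply, Pi.smul_apply,
    measure_univ, smul_eq_mul, mul_one]
  rw [← ENNReal.ofReal_add (by linarith) (by linarith)]
  ring_nf; simp

lemma signLaw_real_singleton {e : ℝ} (he : |e| ≤ 1) (b : Bool) :
    (signLaw e).real {b} = (1 + boolSign b * e) / 2 := by
  have := abs_le.1 he
  rw [measureReal_def]
  cases b
  · simp [signLaw, boolSign, sub_eq_add_neg]; linarith
  · simp [signLaw, boolSign]; linarith

lemma integral_signLaw {e : ℝ} (he : |e| ≤ 1) : ∫ b, boolSign b ∂(signLaw e) = e := by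
  have := signLaw_isProbabilityMeasure he
  rw [integral_fintype (.of_finite)]
  simp only [Fintype.sum_bool, signLaw_real_singleton he, smul_eq_mul]
  simp [boolSign]; ring

variable {X Y : Type*} [MeasurableSpace X] [DiscreteMeasurableSpace X] [Countable X]
  [MeasurableSpace Y] [DiscreteMeasurableSpace Y] [Countable Y]

lemma integral_pi_eq_of_density {d : ℕ} (P M : Fin d → Measure X)
    [∀ j, IsProbabilityMeasure (P j)] [∀ j, IsProbabilityMeasure (M j)] (g : Fin d → X → ℝ)
    (hg : ∀ j x, 0 ≤ g j x) (h : ∀ j x, P j {x} = ENNReal.ofReal (g j x) * M j {x})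
    (F : (Fin d → X) → ℝ) :
    ∫ x, F x ∂(Measure.pi P) = ∫ x, (∏ j, g j (x j)) * F x ∂(Measure.pi M) := by
  have : Measure.pi P =
      (Measure.pi M).withDensity fun x => ENNReal.ofReal (∏ j, g j (x j)) := by
    rw [Measure.ext_iff_singleton]
    intro x
    rw [withDensity_apply _ (MeasurableSet.singleton x), lintegral_singleton,
      Measure.pi_singleton, Measure.pi_singleton,
      ENNReal.ofReal_prod_of_nonneg fun j _ => hg j _, ← Finset.prod_mul_distrib]
    exact Finset.prod_congr rfl fun j _ => h j _
  rw [this, integral_withDensity_eq_integral_toReal_smul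
    Measurable.of_discrete (.of_forall fun x => ENNReal.ofReal_lt_top)]
  congr 1; ext x
  rw [ENNReal.toReal_ofReal (Finset.prod_nonneg fun j _ => hg j _), smul_eq_mul]

/-- Bayes bound: a kernel that maps `d` independent experiments `P (v j)` to within `ε` of the
experiments `Q (v j)`, for all sign vectors `v`, cannot lower the Bayes risk for the
squared loss of the signs by more than the order of the fluctuations. -/
lemma bayes_risk_sub_le {d : ℕ} (P : Bool → Measure X) (Q : Bool → Measure Y) (M : Measure X)
    [∀ b, IsProbabilityMeasure (P b)] [∀ b, IsProbabilityMeasure (Q b)] [IsProbabilityMeasure M]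
    (η : X → ℝ) (hη : ∀ x, |η x| ≤ 1) (t : Y → ℝ) (ht : ∀ y, |t y| ≤ 1)
    (hP : ∀ b x, P b {x} = ENNReal.ofReal (1 + boolSign b * η x) * M {x}) {R : ℝ}
    (hQ : ∀ b, ∫ y, (t y - boolSign b) ^ 2 ∂(Q b) ≤ R)
    (K : Kernel (Fin d → X) (Fin d → Y)) [IsMarkovKernel K] {ε : ℝ} (hε : ε ≤ 1 / 10)
    (hK : ∀ v : Fin d → Bool, TVLe (Measure.pi fun j => Q (v j))
      ((Measure.pi fun j => P (v j)).bind K) ε) :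
    d * (∫ x, (1 - η x ^ 2) ∂M - R) ≤ 20 * √d := by
  classical
  rcases Nat.eq_zero_or_pos d with rfl | hd
  · simp
  by_contra! hcon
  have hd' : (0 : ℝ) < d := by exact_mod_cast hd
  set RX := ∫ x, (1 - η x ^ 2) ∂M with hRX
  set Δ := (d : ℝ) * (RX - R) with hΔ
  have hsq : 0 < √(d : ℝ) := Real.sqrt_pos.2 hd'
  have hΔ0 : 0 < Δ := by linarith
  have hΔ2 : 400 * d ≤ Δ ^ 2 := by
    calc 400 * (d : ℝ) = (20 * √d) ^ 2 := by rw [mul_pow, Real.sq_sqrt hd'.le]; norm_num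
      _ ≤ Δ ^ 2 := by gcongr
  set L : (Fin d → Bool) → (Fin d → Y) → ℝ := fun v y => ∑ j, (t (y j) - boolSign (v j)) ^ 2
    with hL
  -- The typical losses are at most `d R` under the target and at least `d RX = d R + Δ` from the
  -- input. The threshold leaves `Δ / 3` below it for the fluctuations of the target loss, and `2 Δ
  -- / 3` above it, shared by those of the conditional risk and of the signs given the input.
  set θ : ℝ := d * R + Δ / 3 with hθ
  set F : (Fin d → Bool) → (Fin d → Y) → ℝ := fun v => Set.indicator {y | L v y ≤ θ} 1 with hF
  have F0 : ∀ v y, 0 ≤ F v y := fun v y => Set.indicator_nonneg (fun _ _ => zero_le_one) y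
  have F1 : ∀ v y, F v y ≤ 1 := fun v y =>
    Set.indicator_le_self' (fun _ _ => zero_le_one) y
  have posneg : ∀ b x, 0 ≤ 1 + boolSign b * η x := fun b x => by
    have := abs_le.1 (hη x)
    cases b <;> simp [boolSign] <;> linarith
  -- under the target law the loss is small
  have hgood : ∀ v, 16 / 25 ≤ ∫ y, F v y ∂(Measure.pi fun j => Q (v j)) := by
    intro v
    rw [integral_indicator_one MeasurableSet.of_discrete]
    have hch := pi_real_abs_sub_ge_le (fun j => Q (v j)) (fun j y => (t y - boolSign (v j)) ^ 2)
      (B := 4) (c := Δ / 3) (fun j y => by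
        rw [abs_of_nonneg (sq_nonneg _)]
        have h1 := abs_le.1 (ht y)
        cases v j <;> simp only [boolSign] <;> norm_num <;> nlinarith) (by positivity)
    have hcomp : {y | L v y ≤ θ}ᶜ ⊆ {y : Fin d → Y | Δ / 3 ≤
        |∑ j, (t (y j) - boolSign (v j)) ^ 2 -
          ∑ j, ∫ z, (t z - boolSign (v j)) ^ 2 ∂(Q (v j))|} := by
      intro y hy
      simp only [Set.mem_compl_iff, Set.mem_ofPred_eq, not_le, hL] at hy ⊢
      refine le_trans ?_ (le_abs_self _)
      have hm : ∑ j, ∫ z, (t z - boolSign (v j)) ^ 2 ∂(Q (v j)) ≤ ∑ _j : Fin d, R :=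
        Finset.sum_le_sum fun j _ => hQ (v j)
      simp only [Finset.sum_const, Finset.card_univ, Fintype.card_fin, nsmul_eq_mul] at hm
      linarith
    have h2 := (measureReal_mono hcomp).trans hch
    rw [probReal_compl_eq_one_sub MeasurableSet.of_discrete, Fintype.card_fin] at h2
    have h3 : (d : ℝ) * 4 ^ 2 / (Δ / 3) ^ 2 ≤ 9 / 25 := by
      rw [div_le_iff₀ (by positivity)]; nlinarith
    linarith
  have hamp : ∀ v, 27 / 50 ≤ ∫ x, ∫ y, F v y ∂(K x) ∂(Measure.pi fun j => P (v j)) := by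
    intro v
    have := hK v (F v) (F0 v) (F1 v)
    rw [integral_bind_unit _ _ (F0 v) (F1 v)] at this
    linarith [hgood v]
  -- average over the signs
  set W : (Fin d → X) → (Fin d → Bool) → ℝ := fun x v => ∏ j, (1 + boolSign (v j) * η (x j)) / 2
    with hW
  -- Under uniform signs, `W x` is the posterior law given `x`: the signs are independent with means
  -- `η (x j)`.
  have hpost : ∀ x, ∀ G : (Fin d → Bool) → ℝ,
      ∑ v, W x v * G v = ∫ v, G v ∂(Measure.pi fun j => signLaw (η (x j))) := by
    intro x G
    have := fun j => signLaw_isProbabilityMeasure (hη (x j))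
    rw [integral_fintype (.of_finite)]
    refine Finset.sum_congr rfl fun v _ => ?_
    rw [measureReal_def, Measure.pi_singleton, ENNReal.toReal_prod, smul_eq_mul]
    congr 1
    exact Finset.prod_congr rfl fun j _ => (signLaw_real_singleton (hη (x j)) (v j)).symm
  have hKF : ∀ v, ∀ x, 0 ≤ ∫ y, F v y ∂(K x) ∧ ∫ y, F v y ∂(K x) ≤ 1 := fun v x =>
    integral_mem_unit _ (F0 v) (F1 v)
  have hW0 : ∀ x v, 0 ≤ W x v := fun x v => Finset.prod_nonneg fun j _ =>
    div_nonneg (posneg _ _) zero_le_two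
  have hW1 : ∀ x v, W x v ≤ 1 := fun x v => by
    refine Finset.prod_le_one (fun j _ => div_nonneg (posneg _ _) zero_le_two) fun j _ => ?_
    have := abs_le.1 (hη (x j))
    cases v j <;> simp [boolSign] <;> linarith
  have havg : 27 / 50 ≤ ∫ x, ∑ v, W x v * ∫ y, F v y ∂(K x) ∂(Measure.pi fun _ => M) := by
    rw [integral_finsetSum]
    · have : ∀ v, ∫ x, W x v * ∫ y, F v y ∂(K x) ∂(Measure.pi fun _ => M) =
          (1 / 2) ^ d * ∫ x, ∫ y, F v y ∂(K x) ∂(Measure.pi fun j => P (v j)) := by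
        intro v
        rw [integral_pi_eq_of_density (fun j => P (v j)) (fun _ => M)
          (fun j x => 1 + boolSign (v j) * η x) (fun j x => posneg _ _) (fun j x => hP _ _),
          ← integral_const_mul]
        congr 1; ext x
        simp only [hW, Finset.prod_div_distrib, Finset.prod_const, Finset.card_univ,
          Fintype.card_fin]
        rw [one_div, inv_pow]; ring
      simp_rw [this]
      calc (27 / 50 : ℝ) = ∑ _v : Fin d → Bool, (1 / 2 : ℝ) ^ d * (27 / 50) := by
            simp
        _ ≤ _ := by
            refine Finset.sum_le_sum fun v _ => ?_
            gcongr
            exact hamp v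
    · intro v _
      exact integrable_of_mem_unit _ (fun x => mul_nonneg (hW0 x v) (hKF v x).1)
        fun x => mul_le_one₀ (hW1 x v) (hKF v x).1 (hKF v x).2
  -- the posterior probability of a small loss
  set S : Set (Fin d → X) := {x | Δ / 3 ≤ |∑ j, (1 - η (x j) ^ 2) - ∑ _j : Fin d, RX|} with hS
  have hpostle : ∀ x y, ∑ v, W x v * F v y ≤ 9 / 100 + S.indicator 1 x := by
    intro x y
    have := fun j => signLaw_isProbabilityMeasure (hη (x j))
    rw [hpost]
    by_cases hx : x ∈ S
    · rw [Set.indicator_of_mem hx, Pi.one_apply]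
      have := (integral_mem_unit (Measure.pi fun j => signLaw (η (x j))) (f := fun v => F v y)
        (fun v => F0 v y) fun v => F1 v y).2
      linarith
    · rw [Set.indicator_of_notMem hx, add_zero]
      simp only [hS, Set.mem_ofPred_eq, not_le, Finset.sum_const, Finset.card_univ,
        Fintype.card_fin, nsmul_eq_mul] at hx
      have hx := (abs_lt.1 hx).1
      have hch := pi_real_abs_sub_ge_le (fun j => signLaw (η (x j)))
        (fun j b => t (y j) * boolSign b) (B := 1) (c := Δ / 6)
        (fun j b => by rw [abs_mul, abs_boolSign, mul_one]; exact ht _) (by positivity)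
      have e : (fun v => F v y) = Set.indicator {v | L v y ≤ θ} 1 := rfl
      rw [e, integral_indicator_one MeasurableSet.of_discrete]
      refine (measureReal_mono ?_).trans (hch.trans ?_)
      · intro v hv
        simp only [Set.mem_ofPred_eq] at hv ⊢
        refine le_trans ?_ (le_abs_self _)
        simp_rw [integral_const_mul, fun j => integral_signLaw (hη (x j))]
        -- Termwise the difference of the two sides is `(t - η) ^ 2`: no estimate beats the
        -- posterior mean, up to a centred fluctuation of the signs.
        have hpt : ∑ j, ((1 - η (x j) ^ 2) - 2 * (t (y j) * boolSign (v j) - t (y j) * η (x j)))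
            ≤ L v y := by
          refine Finset.sum_le_sum fun j _ => ?_
          have := boolSign_sq (v j)
          nlinarith [sq_nonneg (t (y j) - η (x j))]
        rw [Finset.sum_sub_distrib, ← Finset.mul_sum, Finset.sum_sub_distrib (f := fun j => _ * _)]
          at hpt
        linarith
      · rw [Fintype.card_fin, div_le_iff₀ (by positivity)]
        nlinarith
  have hSle : (Measure.pi fun _ : Fin d => M).real S ≤ 9 / 400 := by
    refine (pi_real_abs_sub_ge_le (fun _ : Fin d => M) (fun _ x => 1 - η x ^ 2) (B := 1)
      (c := Δ / 3) (fun j x => ?_) (by positivity)).trans ?_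
    · have h1 := abs_le.1 (hη x)
      rw [abs_le]; constructor <;> nlinarith
    · rw [Fintype.card_fin, div_le_iff₀ (by positivity)]
      nlinarith
  have hSi : Integrable (fun x => S.indicator (1 : (Fin d → X) → ℝ) x)
      (Measure.pi fun _ : Fin d => M) :=
    integrable_of_mem_unit _ (fun x => Set.indicator_nonneg (fun _ _ => zero_le_one) x)
      fun x => Set.indicator_le_self' (fun _ _ => zero_le_one) x
  have hfin : ∫ x, ∑ v, W x v * ∫ y, F v y ∂(K x) ∂(Measure.pi fun _ => M) ≤
      ∫ x, (9 / 100 + S.indicator 1 x) ∂(Measure.pi fun _ : Fin d => M) := by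
    refine integral_mono ?_ ((integrable_const _).add hSi) fun x => ?_
    · refine integrable_finsetSum _ fun v _ => ?_
      exact integrable_of_mem_unit _ (fun x => mul_nonneg (hW0 x v) (hKF v x).1)
        fun x => mul_le_one₀ (hW1 x v) (hKF v x).1 (hKF v x).2
    · have : ∑ v, W x v * ∫ y, F v y ∂(K x) = ∫ y, ∑ v, W x v * F v y ∂(K x) := by
        rw [integral_finsetSum _ fun v _ =>
          (integrable_of_mem_unit _ (F0 v) (F1 v)).const_mul _]
        simp_rw [integral_const_mul]
      simp only [this]
      calc ∫ y, ∑ v, W x v * F v y ∂(K x) ≤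
            ∫ _, (9 / 100 + S.indicator (1 : (Fin d → X) → ℝ) x) ∂(K x) := by
            refine integral_mono ?_ (integrable_const _) fun y => hpostle x y
            exact integrable_finsetSum _ fun v _ =>
              (integrable_of_mem_unit _ (F0 v) (F1 v)).const_mul _
        _ = _ := by simp
  rw [integral_add (integrable_const _) hSi, integral_indicator_one MeasurableSet.of_discrete]
    at hfin
  simp only [integral_const, probReal_univ, smul_eq_mul, one_mul] at hfin
  -- The success probability would be at least `27 / 50` and at most `9 / 100 + 9 / 400`.
  linarith

end Bayes

/-! ### Posterior mean of one uniform sign. -/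

section SignExperiment

variable {X : Type*} [MeasurableSpace X] [DiscreteMeasurableSpace X] [Countable X]

/-- The mixture of two laws with equal weights. -/
noncomputable def signMixture (P : Bool → Measure X) : Measure X :=
  (2 : ENNReal)⁻¹ • (P true + P false)

/-- The posterior mean of a uniform sign given an observation from `P`. -/
noncomputable def signPosterior (P : Bool → Measure X) (x : X) : ℝ :=
  ((P true).real {x} - (P false).real {x}) / ((P true).real {x} + (P false).real {x})

variable (P : Bool → Measure X) [hP : ∀ b, IsProbabilityMeasure (P b)]

instance : IsProbabilityMeasure (signMixture P) := by
  refine ⟨?_⟩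
  simp only [signMixture, Measure.coe_smul, Measure.coe_add, Pi.smul_apply, Pi.add_apply,
    measure_univ, smul_eq_mul]
  rw [one_add_one_eq_two, ENNReal.inv_mul_cancel two_ne_zero ENNReal.ofNat_ne_top]

lemma abs_signPosterior_le (x : X) : |signPosterior P x| ≤ 1 := by
  have h1 : 0 ≤ (P true).real {x} := measureReal_nonneg
  have h2 : 0 ≤ (P false).real {x} := measureReal_nonneg
  rw [signPosterior, abs_div, abs_of_nonneg (add_nonneg h1 h2)]
  refine div_le_one_of_le₀ ?_ (add_nonneg h1 h2)
  rw [abs_le]; constructor <;> linarith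

lemma one_add_mul_signPosterior_nonneg (b : Bool) (x : X) :
    0 ≤ 1 + boolSign b * signPosterior P x := by
  have := abs_le.1 (abs_signPosterior_le P x)
  cases b <;> simp [boolSign] <;> linarith

lemma singleton_eq_density_mul_signMixture (b : Bool) (x : X) :
    P b {x} = ENNReal.ofReal (1 + boolSign b * signPosterior P x) * signMixture P {x} := by
  have h1 : 0 ≤ (P true).real {x} := measureReal_nonneg
  have h2 : 0 ≤ (P false).real {x} := measureReal_nonneg
  have hM : (signMixture P).real {x} = ((P true).real {x} + (P false).real {x}) / 2 := by
    simp only [signMixture, measureReal_def, Measure.coe_smul, Measure.coe_add, Pi.smul_apply,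
      Pi.add_apply, smul_eq_mul, ENNReal.toReal_mul, ENNReal.toReal_inv, ENNReal.toReal_ofNat]
    rw [ENNReal.toReal_add (measure_ne_top _ _) (measure_ne_top _ _)]
    ring
  rw [← ofReal_measureReal, ← ofReal_measureReal (μ := signMixture P),
    ← ENNReal.ofReal_mul (one_add_mul_signPosterior_nonneg P b x), hM]
  congr 1
  rcases eq_or_ne ((P true).real {x} + (P false).real {x}) 0 with h | h
  · have e1 : (P true).real {x} = 0 := by linarith
    have e2 : (P false).real {x} = 0 := by linarith
    cases b <;> simp [e1, e2]
  · unfold signPosterior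
    cases b <;> simp [boolSign] <;> field_simp <;> ring

lemma integral_eq_integral_signMixture (b : Bool) (F : X → ℝ) :
    ∫ x, F x ∂(P b) = ∫ x, (1 + boolSign b * signPosterior P x) * F x ∂(signMixture P) := by
  have : P b = (signMixture P).withDensity fun x =>
      ENNReal.ofReal (1 + boolSign b * signPosterior P x) := by
    rw [Measure.ext_iff_singleton]
    intro x
    rw [withDensity_apply _ (MeasurableSet.singleton x), lintegral_singleton,
      singleton_eq_density_mul_signMixture]
  conv_lhs => rw [this]
  rw [integral_withDensity_eq_integral_toReal_smul
    Measurable.of_discrete (.of_forall fun x => ENNReal.ofReal_lt_top)]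
  congr 1; ext x
  rw [ENNReal.toReal_ofReal (one_add_mul_signPosterior_nonneg P b x), smul_eq_mul]

lemma integrable_signMixture_of_continuous {φ : ℝ → ℝ} (hφ : Continuous φ) :
    Integrable (fun x => φ (signPosterior P x)) (signMixture P) := by
  obtain ⟨C, hC⟩ := (isCompact_Icc (a := (-1 : ℝ)) (b := 1)).exists_bound_of_continuousOn
    hφ.continuousOn
  exact integrable_of_abs_le _ C fun x => hC _ (abs_le.1 (abs_signPosterior_le P x))

/-- Two laws close in total variation leave the sign undetermined. -/
lemma one_sub_le_bayes_risk {δ : ℝ} (h : TVLe (P true) (P false) δ) :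
    1 - δ ≤ ∫ x, (1 - signPosterior P x ^ 2) ∂(signMixture P) := by
  set η := signPosterior P
  have hb : ∀ x, -1 ≤ η x ∧ η x ≤ 1 := fun x => abs_le.1 (abs_signPosterior_le P x)
  have i1 : Integrable η (signMixture P) := integrable_signMixture_of_continuous P continuous_id
  have i2 : Integrable (fun x => η x ^ 2) (signMixture P) :=
    integrable_signMixture_of_continuous P (continuous_pow 2)
  have h0 : ∫ x, η x ∂(signMixture P) = 0 := by
    have := integral_eq_integral_signMixture P true fun _ => 1
    simp only [boolSign, if_true, one_mul, mul_one] at this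
    rw [integral_add (integrable_const _) i1] at this
    simpa using this
  -- The test `(1 + η) / 2` separates the two laws by exactly `∫ η ^ 2`.
  have key := h (fun x => (1 + η x) / 2) (fun x => by linarith [(hb x).1])
    fun x => by linarith [(hb x).2]
  rw [integral_eq_integral_signMixture P true, integral_eq_integral_signMixture P false] at key
  have e1 : ∫ x, (1 + boolSign true * η x) * ((1 + η x) / 2) ∂(signMixture P) =
      1 / 2 + (1 / 2) * ∫ x, η x ^ 2 ∂(signMixture P) := by
    calc _ = ∫ x, ((1 / 2 + η x) + (1 / 2) * η x ^ 2) ∂(signMixture P) := by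
          congr 1; ext x; simp [boolSign]; ring
      _ = _ := by
          have i3 : Integrable (fun x => 1 / 2 + η x) (signMixture P) := (integrable_const _).add i1
          rw [integral_add i3 (i2.const_mul _), integral_add (integrable_const _) i1,
            integral_const_mul, h0]
          simp
  have e2 : ∫ x, (1 + boolSign false * η x) * ((1 + η x) / 2) ∂(signMixture P) =
      1 / 2 - (1 / 2) * ∫ x, η x ^ 2 ∂(signMixture P) := by
    calc _ = ∫ x, (1 / 2 - (1 / 2) * η x ^ 2) ∂(signMixture P) := by
          congr 1; ext x; simp [boolSign]; ring
      _ = _ := by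
          rw [integral_sub (integrable_const _) (i2.const_mul _), integral_const_mul]
          simp
  rw [e1, e2] at key
  rw [integral_sub (integrable_const _) i2]
  simp only [integral_const, probReal_univ, smul_eq_mul, one_mul]
  linarith

/-- If a measurable involution exchanges the two laws, the risk of the posterior mean is the same
for both signs. -/
lemma integral_signPosterior_sub_sq {σ : X → X} (hσ : Function.Involutive σ)
    (hmap : (P true).map σ = P false) (b : Bool) :
    ∫ x, (signPosterior P x - boolSign b) ^ 2 ∂(P b) =
      ∫ x, (1 - signPosterior P x ^ 2) ∂(signMixture P) := by
  have hmap' : (P false).map σ = P true := by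
    rw [← hmap, Measure.map_map Measurable.of_discrete Measurable.of_discrete, hσ.comp_self,
      Measure.map_id]
  have hpre : ∀ x, σ ⁻¹' {x} = {σ x} := fun x => by
    ext y; simp only [Set.mem_preimage, Set.mem_singleton_iff]
    exact hσ.eq_iff
  have hs : ∀ x, (P true).real {σ x} = (P false).real {x} := fun x => by
    rw [← hmap, map_measureReal_apply Measurable.of_discrete (MeasurableSet.singleton x), hpre]
  have hs' : ∀ x, (P false).real {σ x} = (P true).real {x} := fun x => by
    rw [← hmap', map_measureReal_apply Measurable.of_discrete (MeasurableSet.singleton x), hpre]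
  have hodd : ∀ x, signPosterior P (σ x) = -signPosterior P x := fun x => by
    rw [signPosterior, hs, hs', signPosterior, ← neg_div, neg_sub, add_comm]
  have heq : ∫ x, (signPosterior P x - boolSign false) ^ 2 ∂(P false) =
      ∫ x, (signPosterior P x - boolSign true) ^ 2 ∂(P true) := by
    rw [← hmap, integral_map Measurable.of_discrete.aemeasurable
      Measurable.of_discrete.aestronglyMeasurable]
    congr 1; ext x
    rw [hodd]; simp [boolSign]; ring
  have hsum : ∫ x, (signPosterior P x - boolSign true) ^ 2 ∂(P true) +
      ∫ x, (signPosterior P x - boolSign false) ^ 2 ∂(P false) =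
      2 * ∫ x, (1 - signPosterior P x ^ 2) ∂(signMixture P) := by
    rw [integral_eq_integral_signMixture P true, integral_eq_integral_signMixture P false,
      ← integral_const_mul, ← integral_add]
    · congr 1; ext x; simp [boolSign]; ring
    · exact integrable_signMixture_of_continuous P
        (φ := fun s => (1 + boolSign true * s) * (s - boolSign true) ^ 2) (by fun_prop)
    · exact integrable_signMixture_of_continuous P
        (φ := fun s => (1 + boolSign false * s) * (s - boolSign false) ^ 2) (by fun_prop)
  cases b <;> linarith

end SignExperiment

/-! ### Gain in risk from an additional pair of counts. -/

section PairRisk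

lemma integral_prod_add_sq {X Y : Type*} [MeasurableSpace X] [MeasurableSpace Y]
    {μ : Measure X} {ν : Measure Y} [IsProbabilityMeasure μ] [IsProbabilityMeasure ν]
    {f : X → ℝ} {g : Y → ℝ} (hf : Integrable f μ) (hf2 : Integrable (fun x => f x ^ 2) μ)
    (hg : Integrable g ν) (hg2 : Integrable (fun x => g x ^ 2) ν) (hg0 : ∫ y, g y ∂ν = 0) :
    Integrable (fun z : X × Y => (f z.1 + g z.2) ^ 2) (μ.prod ν) ∧
    ∫ z, (f z.1 + g z.2) ^ 2 ∂(μ.prod ν) = ∫ x, f x ^ 2 ∂μ + ∫ y, g y ^ 2 ∂ν := by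
  have i1 : Integrable (fun z : X × Y => f z.1 ^ 2) (μ.prod ν) := hf2.comp_fst ν
  have i2 : Integrable (fun z : X × Y => g z.2 ^ 2) (μ.prod ν) := hg2.comp_snd μ
  have i3 : Integrable (fun z : X × Y => 2 * (f z.1 * g z.2)) (μ.prod ν) :=
    (hf.mul_prod hg).const_mul 2
  have i4 : Integrable (fun z : X × Y => f z.1 ^ 2 + g z.2 ^ 2) (μ.prod ν) := i1.add i2
  have e : (fun z : X × Y => (f z.1 + g z.2) ^ 2) =
      fun z => (f z.1 ^ 2 + g z.2 ^ 2) + 2 * (f z.1 * g z.2) := by ext z; ring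
  rw [e]
  refine ⟨i4.add i3, ?_⟩
  rw [integral_add i4 i3, integral_add i1 i2, integral_const_mul, integral_prod_mul, hg0]
  have h1 := integral_fun_fst (μ := μ) (ν := ν) fun x => f x ^ 2
  have h2 := integral_fun_snd (μ := μ) (ν := ν) fun x => g x ^ 2
  simp only [probReal_univ, one_smul] at h1 h2
  rw [h1, h2]; ring

variable (s : Bool → ℝ≥0)

/-- Two Poisson counts with total rate `l`, split according to the weights `s b` and `s (!b)`. -/
noncomputable def pairLaw (l : ℝ≥0) (b : Bool) : Measure (ℕ × ℕ) :=
  (poissonMeasure (l * s b)).prod (poissonMeasure (l * s !b))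

instance (l : ℝ≥0) (b : Bool) : IsProbabilityMeasure (pairLaw s l b) := by
  unfold pairLaw; infer_instance

lemma pairLaw_map_swap (l : ℝ≥0) : (pairLaw s l true).map Prod.swap = pairLaw s l false :=
  Measure.prod_swap

lemma tvLe_pairLaw (l : ℝ≥0) {τ : ℝ} (hτ : 0 < τ) :
    TVLe (pairLaw s l true) (pairLaw s l false)
      (2 * (√(l * s true : ℝ≥0) - √(l * s false : ℝ≥0)) ^ 2 / (4 * τ) + τ) := by
  have e : ∀ b, (poissonPi ![l * s b, l * s !b]).map (fun x => (x 0, x 1)) = pairLaw s l b :=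
    fun b => by
      have := (measurePreserving_piFinTwo
        (fun i => poissonMeasure ((![l * s b, l * s !b] : Fin 2 → ℝ≥0) i))).map_eq
      exact this
  rw [← e, ← e]
  have := (tvLe_poissonPi ![l * s true, l * s !true] ![l * s false, l * s !false] hτ).map
    (fun x => (x 0, x 1))
  convert this using 2
  rw [Fin.sum_univ_two]
  simp only [Matrix.cons_val_zero, Matrix.cons_val_one, Matrix.cons_val_fin_one, Bool.not_true,
    Bool.not_false]
  ring

/-- The difference of the two counts of a pair. -/
def pairDiff (y : ℕ × ℕ) : ℝ := y.1 - y.2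

lemma pairDiff_moments (hs : s true + s false = 1) (m : ℝ≥0) (b : Bool) :
    Integrable (fun y => pairDiff y - m * ((s true - s false : ℝ) * boolSign b)) (pairLaw s m b) ∧
    ∫ y, (pairDiff y - m * ((s true - s false : ℝ) * boolSign b)) ∂(pairLaw s m b) = 0 ∧
    Integrable (fun y => (pairDiff y - m * ((s true - s false : ℝ) * boolSign b)) ^ 2)
      (pairLaw s m b) ∧
    ∫ y, (pairDiff y - m * ((s true - s false : ℝ) * boolSign b)) ^ 2 ∂(pairLaw s m b) = m := by
  have hc : ∀ a : ℝ≥0, Integrable (fun n : ℕ => (n : ℝ) - a) (poissonMeasure a) := fun a =>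
    (integrable_natCast_poissonMeasure a).sub (integrable_const _)
  have hc0 : ∀ a : ℝ≥0, ∫ n, ((n : ℝ) - a) ∂(poissonMeasure a) = 0 := fun a => by
    rw [integral_sub (integrable_natCast_poissonMeasure a) (integrable_const _),
      integral_natCast_poissonMeasure]
    simp
  have e : ∀ y : ℕ × ℕ, pairDiff y - m * ((s true - s false : ℝ) * boolSign b) =
      ((y.1 : ℝ) - (m * s b : ℝ≥0)) + -((y.2 : ℝ) - (m * s !b : ℝ≥0)) := by
    intro y
    cases b <;> simp [pairDiff, boolSign] <;> ring
  have hs' : (s true : ℝ) + s false = 1 := by exact_mod_cast hs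
  simp_rw [e]
  have hn : Integrable (fun n : ℕ => -((n : ℝ) - (m * s !b : ℝ≥0))) (poissonMeasure (m * s !b)) :=
    (hc _).neg
  have hn0 : ∫ n : ℕ, -((n : ℝ) - (m * s !b : ℝ≥0)) ∂(poissonMeasure (m * s !b)) = 0 := by
    rw [integral_neg, hc0, neg_zero]
  have key := integral_prod_add_sq (hc (m * s b)) (integrable_sub_sq_poissonMeasure _ _) hn
    (by simp_rw [neg_sq]; exact integrable_sub_sq_poissonMeasure _ _) hn0
  have i1 : Integrable (fun y : ℕ × ℕ => (y.1 : ℝ) - (m * s b : ℝ≥0)) (pairLaw s m b) :=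
    (hc (m * s b)).comp_fst (poissonMeasure (m * s !b))
  have i2 : Integrable (fun y : ℕ × ℕ => -((y.2 : ℝ) - (m * s !b : ℝ≥0))) (pairLaw s m b) :=
    hn.comp_snd (poissonMeasure (m * s b))
  refine ⟨i1.add i2, ?_, key.1, key.2.trans ?_⟩
  · rw [integral_add i1 i2]
    have h1 := integral_fun_fst (μ := poissonMeasure (m * s b)) (ν := poissonMeasure (m * s !b))
      fun n : ℕ => (n : ℝ) - (m * s b : ℝ≥0)
    have h2 := integral_fun_snd (μ := poissonMeasure (m * s b)) (ν := poissonMeasure (m * s !b))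
      fun n : ℕ => -((n : ℝ) - (m * s !b : ℝ≥0))
    rw [hc0, smul_zero] at h1
    rw [hn0, smul_zero] at h2
    unfold pairLaw
    rw [h1, h2, add_zero]
  · simp only [neg_sq, integral_sub_sq_poissonMeasure]
    push_cast
    cases b <;> simp only [Bool.not_true, Bool.not_false] <;> linear_combination (m : ℝ) * hs'

/-- The posterior mean from a first pair, corrected linearly with a second pair, and truncated. -/
noncomputable def pairEstimator (l m : ℝ≥0) (a : ℝ) (z : (ℕ × ℕ) × (ℕ × ℕ)) : ℝ :=
  max (-1) (min 1 (signPosterior (pairLaw s l) z.1 +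
    a * (pairDiff z.2 - m * ((s true - s false : ℝ) * signPosterior (pairLaw s l) z.1))))

lemma abs_pairEstimator_le (l m : ℝ≥0) (a : ℝ) (z : (ℕ × ℕ) × (ℕ × ℕ)) :
    |pairEstimator s l m a z| ≤ 1 := by
  rw [abs_le]
  exact ⟨le_max_left _ _, max_le (by norm_num) (min_le_left _ _)⟩

lemma clip_sub_sq_le (u : ℝ) (b : Bool) :
    (max (-1) (min 1 u) - boolSign b) ^ 2 ≤ (u - boolSign b) ^ 2 := by
  rcases le_total 1 u with h | h
  · rw [min_eq_left h, max_eq_right (by norm_num)]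
    cases b <;> simp only [boolSign] <;> norm_num <;> nlinarith
  · rw [min_eq_right h]
    rcases le_total (-1) u with h' | h'
    · rw [max_eq_right h']
    · rw [max_eq_left h']
      cases b <;> simp only [boolSign] <;> norm_num <;> nlinarith

/-- Before truncation the error is `(1 - a m δ) (η - v)` plus `a` times the centred difference of
the second pair, where `δ = s true - s false` and `v` is the sign. The terms are independent and the
second has mean zero, so the squares add up; truncation to `[-1, 1]` can only help. -/
lemma pairEstimator_risk_le (hs : s true + s false = 1) (l m : ℝ≥0) (a : ℝ) (b : Bool) :
    ∫ z, (pairEstimator s l m a z - boolSign b) ^ 2 ∂((pairLaw s l b).prod (pairLaw s m b)) ≤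
      (1 - a * m * (s true - s false)) ^ 2 *
        ∫ x, (1 - signPosterior (pairLaw s l) x ^ 2) ∂(signMixture (pairLaw s l)) + a ^ 2 * m := by
  obtain ⟨j1, j2, j3, j4⟩ := pairDiff_moments s hs m b
  set η := signPosterior (pairLaw s l)
  set δ : ℝ := s true - s false
  have hη : ∀ x, |η x - boolSign b| ≤ 2 := fun x => by
    have := abs_signPosterior_le (pairLaw s l) x
    calc |η x - boolSign b| ≤ |η x| + |boolSign b| := abs_sub _ _
      _ ≤ 2 := by rw [abs_boolSign]; linarith
  have hf : Integrable (fun x => (1 - a * m * δ) * (η x - boolSign b)) (pairLaw s l b) :=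
    (integrable_of_abs_le _ 2 hη).const_mul _
  have hf2 : Integrable (fun x => ((1 - a * m * δ) * (η x - boolSign b)) ^ 2) (pairLaw s l b) := by
    simp_rw [mul_pow]
    refine (integrable_of_abs_le _ 4 fun x => ?_).const_mul _
    rw [abs_of_nonneg (sq_nonneg _), ← sq_abs]
    nlinarith [hη x, abs_nonneg (η x - boolSign b)]
  have key := integral_prod_add_sq hf hf2 (j1.const_mul a)
    (by simp_rw [mul_pow]; exact j3.const_mul _) (by rw [integral_const_mul, j2, mul_zero])
  simp_rw [mul_pow] at key
  rw [integral_const_mul, integral_const_mul, j4,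
    integral_signPosterior_sub_sq _ Prod.swap_swap (pairLaw_map_swap s l)] at key
  rw [← key.2]
  refine integral_mono ?_ key.1 fun z => ?_
  · refine integrable_of_abs_le _ 4 fun z => ?_
    have h1 := abs_le.1 (abs_pairEstimator_le s l m a z)
    rw [abs_of_nonneg (sq_nonneg _)]
    cases b <;> simp only [boolSign] <;> norm_num <;> nlinarith
  · refine (clip_sub_sq_le _ b).trans (le_of_eq ?_)
    ring

end PairRisk

/-! ### Tilted pairs of categories and the bound on `m`. -/

section LowerBound

/-- Rates of `d` pairs of categories, the pairs having equal weights and the `j`-th one being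
tilted according to the sign `v j`. -/
noncomputable def pairRates {d : ℕ} (s : Bool → ℝ≥0) (v : Fin d → Bool) : Fin d ⊕ Fin d → ℝ≥0 :=
  Sum.elim (fun j => s (v j) / d) fun j => s (!v j) / d

/-- The array of pairs of counts. -/
def pairCounts {d : ℕ} (x : Fin d ⊕ Fin d → ℕ) : Fin d → ℕ × ℕ :=
  fun j => (x (Sum.inl j), x (Sum.inr j))

/-- Inverse of `pairCounts`. -/
def unpairCounts {d : ℕ} (z : Fin d → ℕ × ℕ) : Fin d ⊕ Fin d → ℕ :=
  Sum.elim (fun j => (z j).1) fun j => (z j).2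

lemma sum_pairRates {d : ℕ} (hd : 1 ≤ d) {s : Bool → ℝ≥0} (hs : s true + s false = 1)
    (v : Fin d → Bool) : ∑ i, pairRates s v i = 1 := by
  have hd' : (d : ℝ≥0) ≠ 0 := by exact_mod_cast (by omega : d ≠ 0)
  rw [Fintype.sum_sum_type]
  simp only [pairRates, Sum.elim_inl, Sum.elim_inr]
  rw [← Finset.sum_add_distrib]
  have : ∀ j, s (v j) / (d : ℝ≥0) + s (!v j) / d = 1 / d := fun j => by
    rw [← add_div]
    cases v j
    · rw [Bool.not_false, add_comm, hs]
    · rw [Bool.not_true, hs]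
  simp_rw [this]
  simp [hd']

lemma poissonPi_map_pairCounts {d : ℕ} (s : Bool → ℝ≥0) (v : Fin d → Bool) (c : ℝ≥0) :
    (poissonPi (c • pairRates s v)).map pairCounts =
      Measure.pi fun j => pairLaw s (c / d) (v j) := by
  rw [Measure.ext_iff_singleton]
  intro z
  have hpre : pairCounts ⁻¹' {z} = {unpairCounts z} := by
    ext x
    simp only [Set.mem_preimage, Set.mem_singleton_iff]
    constructor
    · rintro rfl
      ext i
      cases i <;> rfl
    · rintro rfl
      rfl
  rw [Measure.map_apply Measurable.of_discrete (MeasurableSet.singleton z), hpre]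
  simp only [poissonPi, pairLaw, Measure.pi_singleton]
  rw [Fintype.prod_sum_type, ← Finset.prod_mul_distrib]
  refine Finset.prod_congr rfl fun j _ => ?_
  rw [show ({z j} : Set (ℕ × ℕ)) = {(z j).1} ×ˢ {(z j).2} by simp, Measure.prod_prod]
  simp only [pairRates, unpairCounts, Sum.elim_inl, Sum.elim_inr, Pi.smul_apply, smul_eq_mul]
  rw [mul_div_assoc', div_mul_eq_mul_div, mul_div_assoc', div_mul_eq_mul_div]

lemma pi_pairLaw_map_unpairCounts {d : ℕ} (s : Bool → ℝ≥0) (v : Fin d → Bool) (c : ℝ≥0) :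
    (Measure.pi fun j => pairLaw s (c / d) (v j)).map unpairCounts =
      poissonPi (c • pairRates s v) := by
  rw [← poissonPi_map_pairCounts, Measure.map_map Measurable.of_discrete Measurable.of_discrete]
  have : (unpairCounts ∘ pairCounts : (Fin d ⊕ Fin d → ℕ) → _) = id := by
    ext x i
    cases i <;> rfl
  rw [this, Measure.map_id]

lemma prod_map_pairCounts {d : ℕ} (s : Bool → ℝ≥0) (v : Fin d → Bool) (c c' : ℝ≥0) :
    ((poissonPi (c • pairRates s v)).prod (poissonPi (c' • pairRates s v))).map
      (fun z j => (pairCounts z.1 j, pairCounts z.2 j)) =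
      Measure.pi fun j => (pairLaw s (c / d) (v j)).prod (pairLaw s (c' / d) (v j)) := by
  have h := (measurePreserving_arrowProdEquivProdArrow (ℕ × ℕ) (ℕ × ℕ) (Fin d)
    (fun j => pairLaw s (c / d) (v j)) (fun j => pairLaw s (c' / d) (v j))).symm.map_eq
  rw [← h, ← poissonPi_map_pairCounts, ← poissonPi_map_pairCounts,
    Measure.map_prod_map _ _ Measurable.of_discrete Measurable.of_discrete,
    Measure.map_map Measurable.of_discrete Measurable.of_discrete]
  rfl

lemma AdmitsAmplification.le_div_sqrt {k n m d : ℕ} {ε : ℝ} (hε : ε ≤ 1 / 10) (hd : 1 ≤ d)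
    (hdk : d + d ≤ k) (hdn : d ≤ n) (hm : m ≤ 20 * n)
    (h : AdmitsAmplification (poissonizedModel k) n m ε) : (m : ℝ) ≤ 3200 * (n / √d) := by
  have hd0 : (0 : ℝ) < d := by exact_mod_cast hd
  have hn0 : (0 : ℝ) < n := by exact_mod_cast hd.trans hdn
  have hdn' : (d : ℝ) ≤ n := by exact_mod_cast hdn
  have hm' : (m : ℝ) ≤ 20 * n := by exact_mod_cast hm
  obtain ⟨K, hK, h⟩ := h.exists_kernel (f := Fin.castLE hdk ∘ finSumFinEquiv)
    ((Fin.castLE_injective hdk).comp finSumFinEquiv.injective)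
  -- The tilt is chosen so that `l δ ^ 2 = 1 / 20`, where `l = n / d` is the expected input count of
  -- a pair: the sign stays uncertain. The hypothesis `d ≤ n` ensures `δ ≤ 1`.
  set δ : ℝ := √(d / (20 * n)) with hδ
  have hδ2 : δ ^ 2 = d / (20 * n) := Real.sq_sqrt (by positivity)
  have hδ0 : 0 ≤ δ := Real.sqrt_nonneg _
  have hδ1 : δ ≤ 1 := by
    rw [hδ, Real.sqrt_le_iff, one_pow, div_le_one (by positivity)]
    exact ⟨zero_le_one, by linarith⟩
  set s : Bool → ℝ≥0 := fun b => Real.toNNReal ((1 + boolSign b * δ) / 2) with hs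
  have hst : (s true : ℝ) = (1 + δ) / 2 := by
    simp only [hs, boolSign, if_true, one_mul]
    exact Real.coe_toNNReal _ (by positivity)
  have hsf : (s false : ℝ) = (1 - δ) / 2 := by
    simp only [hs, boolSign]
    rw [Real.coe_toNNReal _ (by norm_num; linarith)]
    norm_num; ring
  have hs1 : s true + s false = 1 := by
    rw [← NNReal.coe_inj]; push_cast; rw [hst, hsf]; ring
  have hsd : (s true : ℝ) - s false = δ := by rw [hst, hsf]; ring
  set l : ℝ≥0 := n / d with hl
  set u : ℝ≥0 := m / d with hu
  have hl' : (l : ℝ) = n / d := by simp [hl]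
  have hu' : (u : ℝ) = m / d := by simp [hu]
  have hl0 : (0 : ℝ) < l := by rw [hl']; positivity
  have hlδ : l * δ ^ 2 = 1 / 20 := by rw [hl', hδ2]; field_simp
  set q : ℝ := u * δ ^ 2 with hq
  have hq' : q = m / (20 * n) := by rw [hq, hu', hδ2]; field_simp
  have hq0 : 0 ≤ q := by positivity
  have hq1 : q ≤ 1 := by rw [hq', div_le_one (by positivity)]; exact hm'
  -- the two laws of one pair are close
  have hD : (√(l * s true : ℝ≥0) - √(l * s false : ℝ≥0)) ^ 2 ≤ 1 / 20 := by
    have e1 : √(l * s true : ℝ≥0) ^ 2 = l * ((1 + δ) / 2) := by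
      rw [Real.sq_sqrt (NNReal.coe_nonneg _), NNReal.coe_mul, hst]
    have e2 : √(l * s false : ℝ≥0) ^ 2 = l * ((1 - δ) / 2) := by
      rw [Real.sq_sqrt (NNReal.coe_nonneg _), NNReal.coe_mul, hsf]
    set A := √(l * s true : ℝ≥0)
    set B := √(l * s false : ℝ≥0)
    have hAB : 0 ≤ A * B := mul_nonneg (Real.sqrt_nonneg _) (Real.sqrt_nonneg _)
    refine le_of_mul_le_mul_right ?_ hl0
    calc (A - B) ^ 2 * l = (A - B) ^ 2 * (A ^ 2 + B ^ 2) := by rw [e1, e2]; ring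
      _ ≤ (A - B) ^ 2 * (A + B) ^ 2 := by
          refine mul_le_mul_of_nonneg_left ?_ (sq_nonneg _)
          nlinarith
      _ = (A ^ 2 - B ^ 2) ^ 2 := by ring
      _ = 1 / 20 * l := by rw [e1, e2, ← hlδ]; ring
  have hR := one_sub_le_bayes_risk (pairLaw s l)
    ((tvLe_pairLaw s l (by norm_num : (0 : ℝ) < 1 / 6)).mono (ε' := 19 / 60) (by
      rw [show (4 * (1 / 6) : ℝ) = 2 / 3 by norm_num, div_add' _ _ _ (by norm_num),
        div_le_iff₀ (by norm_num)]
      linarith))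
  set R := ∫ x, (1 - signPosterior (pairLaw s l) x ^ 2) ∂(signMixture (pairLaw s l)) with hRdef
  let G : (Fin d ⊕ Fin d → ℕ) × (Fin d ⊕ Fin d → ℕ) → Fin d → (ℕ × ℕ) × (ℕ × ℕ) :=
    fun z j => (pairCounts z.1 j, pairCounts z.2 j)
  have hK' : ∀ v : Fin d → Bool,
      TVLe (Measure.pi fun j => (pairLaw s l (v j)).prod (pairLaw s u (v j)))
        ((Measure.pi fun j => pairLaw s l (v j)).bind
          ((K ∘ₖ Kernel.deterministic unpairCounts Measurable.of_discrete).map G)) ε := by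
    intro v
    have := ((h (pairRates s v) (sum_pairRates hd hs1 v)).symm).map G
    rw [prod_map_pairCounts] at this
    rw [← Measure.map_comp _ _ Measurable.of_discrete, ← Measure.comp_assoc,
      Measure.deterministic_comp_eq_map, pi_pairLaw_map_unpairCounts]
    exact this
  have : IsMarkovKernel ((K ∘ₖ Kernel.deterministic (unpairCounts (d := d))
      Measurable.of_discrete).map G) := Kernel.IsMarkovKernel.map _ Measurable.of_discrete
  have key := bayes_risk_sub_le (pairLaw s l) (fun b => (pairLaw s l b).prod (pairLaw s u b))
    (signMixture (pairLaw s l)) (signPosterior (pairLaw s l)) (abs_signPosterior_le _)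
    (pairEstimator s l u (δ / 2)) (abs_pairEstimator_le s l u _)
    (singleton_eq_density_mul_signMixture _) (pairEstimator_risk_le s hs1 l u (δ / 2)) _ hε hK'
  rw [hsd, ← hRdef] at key
  -- With `a = δ / 2` the gain is `q (R (1 - q / 4) - 1 / 4)`, and `R ≥ 41 / 60`, `q ≤ 1` bound the
  -- second factor below by `1 / 8`.
  have hgap : q / 8 ≤ R - ((1 - δ / 2 * u * δ) ^ 2 * R + (δ / 2) ^ 2 * u) := by
    have e : R - ((1 - δ / 2 * u * δ) ^ 2 * R + (δ / 2) ^ 2 * u) =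
        q * (R * (1 - q / 4) - 1 / 4) := by rw [hq]; ring
    rw [e, div_eq_mul_one_div]
    refine mul_le_mul_of_nonneg_left ?_ hq0
    nlinarith
  have h1 : (d : ℝ) * (q / 8) ≤ 20 * √d := (mul_le_mul_of_nonneg_left hgap hd0.le).trans key
  have hsq : 0 < √(d : ℝ) := Real.sqrt_pos.2 hd0
  have hsq2 : √(d : ℝ) * √d = d := Real.mul_self_sqrt hd0.le
  have h2 : √(d : ℝ) * q ≤ 160 := by
    refine le_of_mul_le_mul_left ?_ hsq
    rw [← mul_assoc, hsq2]; linarith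
  rw [hq', mul_div_assoc', div_le_iff₀ (by positivity)] at h2
  rw [mul_div_assoc', le_div_iff₀ hsq]
  linarith

lemma AdmitsAmplification.le_mul {k n m : ℕ} {ε : ℝ} (hε : ε ≤ 1 / 10) (hk : 2 ≤ k) (hn : 1 ≤ n)
    (hm : m ≤ 20 * n) (h : AdmitsAmplification (poissonizedModel k) n m ε) :
    (m : ℝ) ≤ 6400 * (n / √k + √n) := by
  have hk0 : (0 : ℝ) < k := by exact_mod_cast (by omega : 0 < k)
  have hn0 : (0 : ℝ) < n := by exact_mod_cast hn
  have hsn : 0 < √(n : ℝ) := Real.sqrt_pos.2 hn0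
  have hsk : 0 < √(k : ℝ) := Real.sqrt_pos.2 hk0
  -- The number of pairs is `d = min n (k / 2)`; with `d = n` the bound `n / √d` is `√n`.
  rcases le_total n (k / 2) with hnk | hnk
  · have := h.le_div_sqrt hε hn (by omega) le_rfl hm
    rw [Real.div_sqrt] at this
    have : 0 ≤ (n : ℝ) / √k := by positivity
    linarith
  · have := h.le_div_sqrt (d := k / 2) hε (by omega) (by omega) hnk hm
    have h4 : (k : ℝ) ≤ 4 * (k / 2 : ℕ) := by exact_mod_cast (by omega : k ≤ 4 * (k / 2))
    have h5 : √(k : ℝ) ≤ 2 * √((k / 2 : ℕ) : ℝ) := by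
      calc √(k : ℝ) ≤ √(2 ^ 2 * (k / 2 : ℕ)) := Real.sqrt_le_sqrt (by linarith)
        _ = _ := by rw [Real.sqrt_mul (by norm_num), Real.sqrt_sq (by norm_num)]
    have h6 : (n : ℝ) / √((k / 2 : ℕ) : ℝ) ≤ 2 * (n / √k) := by
      have hpos : 0 < √((k / 2 : ℕ) : ℝ) := by linarith
      rw [mul_div_assoc', div_le_div_iff₀ hpos hsk]
      nlinarith
    linarith

end LowerBound

theorem mainTheorem11 (ε : ℝ) (hε₀ : 0 < ε) (hε : ε ≤ 1 / 10) :
    ∃ c : ℝ, 0 < c ∧ ∃ C : ℝ, 0 < C ∧ ∃ n₀ : ℕ,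
      (∀ k n m : ℕ, 1 ≤ k →
        (m : ℝ) ≤ c * ((n : ℝ) / Real.sqrt k + Real.sqrt n) →
          AdmitsAmplification (poissonizedModel k) n m ε) ∧
      (∀ k n : ℕ, 1 ≤ k → n₀ ≤ n →
          AdmitsAmplification (poissonizedModel k) n 1 ε) ∧
      (∀ k n m : ℕ, 2 ≤ k → 1 ≤ m →
        AdmitsAmplification (poissonizedModel k) n m ε →
          1 ≤ n ∧ (m : ℝ) ≤ C * ((n : ℝ) / Real.sqrt k + Real.sqrt n)) := by
  -- The sum `n / √k + √n` is at most twice its larger term, whence `ε / 4` from the constants `ε`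
  -- and `ε / 2` of the two procedures. The choice of `n₀` gives `1 ≤ ε √n`.
  refine ⟨ε / 4, by positivity, 6400, by norm_num, ⌈1 / ε ^ 2⌉₊, ?_, ?_, ?_⟩
  · intro k n m hk h
    rcases le_total ((n : ℝ) / √k) (√n) with hle | hle
    · refine admitsAmplification_of_le_sqrt hε₀ (h.trans ?_)
      nlinarith [Real.sqrt_nonneg (n : ℝ)]
    · refine admitsAmplification_of_le_div_sqrt hε₀ hk (h.trans ?_)
      nlinarith
  · intro k n _ hn
    refine admitsAmplification_of_le_sqrt hε₀ ?_
    have h1 : 1 / ε ^ 2 ≤ n := (Nat.le_ceil _).trans (by exact_mod_cast hn)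
    have h2 := Real.sqrt_le_sqrt h1
    rw [Real.sqrt_div zero_le_one, Real.sqrt_one, Real.sqrt_sq hε₀.le, div_le_iff₀ hε₀] at h2
    rw [Nat.cast_one]; linarith
  · intro k n m hk hm h
    have hlt := h.lt_mul hε hk hm
    have hn : 1 ≤ n := by omega
    exact ⟨hn, h.le_mul hε hk hn hlt.le⟩
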